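/- **Setting.** An instance consists of $n$ items; item $e$ has a value $v(e)\ge 0$ and a size $s(e)\in\mathbb R^d_{\ge0}$, $d\ge1$. For a cost function $g:\mathbb R^d_{\ge 0}\to\mathbb R$, the profit of a set $A$ of items is $\pi(A)=\sum_{e\in A}v(e)-g\big(\sum_{e\in A}s(e)\big)$; every set may be chosen, and $\mathrm{opt}=\max_A\pi(A)$. For a collection $L$ of items let $\mathrm{fopt}(L)=\sup_{x\in[0,1]^L}\big(\sum_{e\in L} x_ev(e)-g(\sum_{e\in L} x_es(e))\big)$. The items arrive in uniformly random order; a randomized online algorithm knows $g$, $d$ and $n$, sees $v(e),s(e)$ when $e$ arrives, and must then irrevocably accept or reject $e$. The cost $g$ is called *regular supermodular* if it is non-negative, strictly convex and differentiable on $\mathbb R^d_{\ge0}$ (at the boundary: relative to $\mathbb R^d_{\ge 0}$), $g(0)=0$, $g(x)+g(y)\le g(x\wedge y)+g(x\vee y)$ for all $x,y$ (componentwise minimum and maximum), and its gradient goes to infinity along every ray: $\langle\nabla g(tz),z\rangle\to\infty$ as $t\to\infty$ for every $0\ne z\in\mathbb R^d_{\ge0}$. Let $g_i^\star(\ell)=\sup_{x\ge0}\big(\ell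 x-g(x\mathbf e_i)\big)$. A *balanced curve* is a set $\mathcal C=\{\gamma(t):t\ge0\}\subseteq\mathbb R^d_{\ge0}$ with $\gamma$ continuous, coordinatewise non-decreasing, $\gamma(0)=0$, every coordinate tending to $\infty$, and $g_i^\star(\lambda_i)=g_j^\star(\lambda_j)$ for all $\lambda\in\mathcal C$ and all $i,j$. **Algorithm 1** (for $g$, $\mathcal C$, $n$). 1. Draw $k\sim\mathrm{Binomial}(n,\tfrac12)$, independently of the arrival order; reject the first $k$ items and call them $L$. 2. Let $\mu$ be the largest $\lambda\in\mathcal C$ with $\mathrm{fopt}(L_\lambda)\ge\frac1{12d}\mathrm{fopt}(L)$, where $L_\lambda=\{e\in L: v(e)\ge\langle\lambda,s(e)\rangle\}$. 3. Among the remaining items consider only those with $v(e)>\langle\mu,s(e)\rangle$, and accept such an item exactly if adding it to the current solution does not decrease the profit. (If no largest $\lambda$ exists in step 2, which happens only when all of $\mathcal C$ qualifies, the condition in step 3 is replaced by: $v(e)>\langle\lambda,s(e)\rangle$ for all $\lambda\in\mathcal C$.) An item $e$ is *exceptional* if every maximizer of $\theta\mapsto\theta v(e)-g(\theta s(e))$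 over $[0,1]$ lies in $(0,1)$. An instance is *nice* for $\mathcal C$ if no item is exceptional, every single item has profit at most $\mathrm{opt}/(10^4d)$, and the items are in general position: for every $\lambda\in\mathcal C$ at most one item has $v(e)=\langle\lambda,s(e)\rangle$. **Theorem (Unconstrained & Supermodular).** There is an absolute constant $K>0$ such that for every $d\ge1$ and every regular supermodular cost $g$ on $\mathbb R^d_{\ge0}$: 1. a balanced curve for $g$ exists; 2. for every balanced curve $\mathcal C$, every $n$ and every nice instance with $n$ items, Algorithm 1 is $O(d)$-competitive: its profit $\mathrm{ALG}$ satisfies $\mathrm{opt}\le K\,d\;\mathbb E[\mathrm{ALG}]$; 3. without any assumption on the items: for every $n$ there is a randomized online algorithm such that $\mathrm{opt}\le K\,d\;\mathbb E[\mathrm{ALG}]$ for every instance with $n$ items. Expectations are over the random arrival order and the internal randomness of the algorithm. -/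

import Mathlib

open Set Filter MeasureTheory
open scoped Matrix Classical

noncomputable section

/-! ### Items, profits and optima -/

/-- An item with a non-negative value and a non-negative `d`-dimensional size. -/
structure Item (d : ℕ) where
  value : ℝ
  size : Fin d → ℝ
  value_nonneg : 0 ≤ value
  size_nonneg : 0 ≤ size

/-- Total value minus the cost of the total size, for a collection of items. -/
def profit {d : ℕ} (g : (Fin d → ℝ) → ℝ) (A : Multiset (Item d)) : ℝ :=
  (A.map Item.value).sum - g (A.map Item.size).sum

/-- The best profit of a subset of the items (there is no feasibility constraint). -/
def opt {d n : ℕ} (g : (Fin d → ℝ) → ℝ) (items : Fin n → Item d) : ℝ :=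
  (Finset.univ : Finset (Finset (Fin n))).sup' Finset.univ_nonempty
    (fun A => profit g (A.val.map items))

/-- The best fractional profit: every item of the list may be taken to an extent in `[0, 1]`. -/
def fopt {d : ℕ} (g : (Fin d → ℝ) → ℝ) (L : List (Item d)) : ℝ :=
  sSup ((fun x : Fin L.length → ℝ =>
      ∑ i, x i * (L.get i).value - g (∑ i, x i • (L.get i).size)) '' Set.Icc 0 1)

/-! ### Cost functions -/

/-- The regularity conditions on a supermodular convex cost function `g` on the orthant
`ℝ^d_{≥0} = Set.Ici 0` (only the values of `g` there matter). Differentiability is meant relative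
to the orthant, boundary included; in particular `g` is continuous there, hence closed. -/
structure IsRegularSupermodularCost {d : ℕ} (g : (Fin d → ℝ) → ℝ) : Prop where
  nonneg : ∀ z, 0 ≤ z → 0 ≤ g z
  map_zero : g 0 = 0
  strictConvex : StrictConvexOn ℝ (Set.Ici 0) g
  differentiable : DifferentiableOn ℝ g (Set.Ici 0)
  supermodular : ∀ x y, 0 ≤ x → 0 ≤ y → g x + g y ≤ g (x ⊓ y) + g (x ⊔ y)
  /-- The gradients go to infinity along every ray of the orthant: `⟨∇g(t z), z⟩ → ∞`. -/
  gradient_tendsto : ∀ z, 0 ≤ z → z ≠ 0 →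
    Tendsto (fun t : ℝ => fderivWithin ℝ g (Set.Ici 0) (t • z) z) atTop atTop

/-- The convex dual of the `i`-th marginal function `x ↦ g (x eᵢ)`, `x ≥ 0`. -/
def marginalDual {d : ℕ} (g : (Fin d → ℝ) → ℝ) (i : Fin d) (l : ℝ) : ℝ :=
  sSup ((fun x : ℝ => l * x - g (Pi.single i x)) '' Set.Ici 0)

/-! ### Classifiers -/

/-- `C` is a monotone curve from the origin to infinity (in every coordinate) which is balanced:
the duals of all marginals agree at each of its points. -/
def IsBalancedCurve {d : ℕ} (g : (Fin d → ℝ) → ℝ) (C : Set (Fin d → ℝ)) : Prop :=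
  ∃ γ : NNReal → Fin d → ℝ,
    Continuous γ ∧ Monotone γ ∧ γ 0 = 0 ∧ (∀ i, Tendsto (fun t => γ t i) atTop atTop) ∧
    (∀ t i j, marginalDual g i (γ t i) = marginalDual g j (γ t j)) ∧
    C = Set.range γ

/-- The items of `L` picked by the classifier `l`. -/
def picked {d : ℕ} (l : Fin d → ℝ) (L : List (Item d)) : List (Item d) :=
  L.filter (fun e => l ⬝ᵥ e.size ≤ e.value)

/-- An item is exceptional if it is best to take it to an extent strictly between 0 and 1:
all maximizers of `θ ↦ θ v(e) - g(θ s(e))` over `[0, 1]` lie in `(0, 1)`. -/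
def IsExceptional {d : ℕ} (g : (Fin d → ℝ) → ℝ) (e : Item d) : Prop :=
  ∀ θ ∈ Set.Icc (0 : ℝ) 1,
    IsMaxOn (fun θ : ℝ => θ * e.value - g (θ • e.size)) (Set.Icc 0 1) θ → θ ∈ Set.Ioo (0 : ℝ) 1

/-- Items in general position with respect to the curve `C`, none of them exceptional, and each
of profit at most `opt / (10^4 d)`. -/
structure IsNiceInstance {d n : ℕ} (g : (Fin d → ℝ) → ℝ) (C : Set (Fin d → ℝ))
    (items : Fin n → Item d) : Prop where
  general_position : ∀ l ∈ C, ∀ i j, (items i).value = l ⬝ᵥ (items i).size →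
    (items j).value = l ⬝ᵥ (items j).size → i = j
  not_exceptional : ∀ i, ¬ IsExceptional g (items i)
  small_profit : ∀ i, profit g {items i} ≤ opt g items / (10 ^ 4 * d)

/-! ### Online algorithms in the random-order model -/

/-- A randomized online algorithm: given its random seed, the items that arrived before (in order
of arrival) and the current item, it irrevocably decides whether to accept the current item.
(The earlier decisions are determined by the seed and the earlier items.) -/
structure RandomizedOnlineAlgorithm (d : ℕ) where
  Seed : Type
  measurableSpace : MeasurableSpace Seed
  law : Measure Seed
  isProbabilityMeasure : IsProbabilityMeasure law
  accept : Seed → List (Item d) → Item d → Prop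
  measurableSet_accept : ∀ past e, MeasurableSet {ω | accept ω past e}

/-- The items accepted when the `t`-th arriving item is `arrival t`. -/
def RandomizedOnlineAlgorithm.accepted {d n : ℕ} (𝒜 : RandomizedOnlineAlgorithm d) (ω : 𝒜.Seed)
    (arrival : Fin n → Item d) : Multiset (Item d) :=
  (Finset.univ.filter fun t : Fin n =>
    𝒜.accept ω ((List.ofFn arrival).take t) (arrival t)).val.map arrival

/-- The expected profit when the items arrive in uniformly random order, independent of the
random seed of the algorithm. -/
def RandomizedOnlineAlgorithm.expectedProfit {d n : ℕ} (𝒜 : RandomizedOnlineAlgorithm d)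
    (g : (Fin d → ℝ) → ℝ) (items : Fin n → Item d) : ℝ :=
  letI := 𝒜.measurableSpace
  (∑ σ : Equiv.Perm (Fin n), ∫ ω, profit g (𝒜.accepted ω (items ∘ σ)) ∂𝒜.law) / (n.factorial : ℝ)

/-! ### The algorithm -/

/-- The classifiers on the curve `C` whose picked part of the sample `L` has fractional optimum at
least a `1 / (12 d)` fraction of that of `L`. -/
def candidates {d : ℕ} (g : (Fin d → ℝ) → ℝ) (C : Set (Fin d → ℝ)) (L : List (Item d)) :
    Set (Fin d → ℝ) :=
  {l | l ∈ C ∧ 1 / (12 * d) * fopt g L ≤ fopt g (picked l L)}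

/-- The item `e` passes the (strict) filter given by the largest candidate classifier. If the
candidates are unbounded along the curve (a degenerate case), the learned classifier is the point
at infinity of the curve: `e` passes if it passes for all classifiers on the curve. -/
def PassesFilter {d : ℕ} (g : (Fin d → ℝ) → ℝ) (C : Set (Fin d → ℝ)) (L : List (Item d))
    (e : Item d) : Prop :=
  if h : ∃ l, IsGreatest (candidates g C L) l then h.choose ⬝ᵥ e.size < e.value
  else ∀ l ∈ C, l ⬝ᵥ e.size < e.value

/-- The item `e` passes the filter `P`, and adding it to the current solution `A` does not decrease
the profit. -/
def GreedyAccepts {d : ℕ} (g : (Fin d → ℝ) → ℝ) (P : Item d → Prop) (A : Multiset (Item d))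
    (e : Item d) : Prop :=
  P e ∧ profit g A ≤ profit g (e ::ₘ A)

/-- The solution obtained from a list of arriving items by accepting greedily. -/
def greedySolution {d : ℕ} (g : (Fin d → ℝ) → ℝ) (P : Item d → Prop) (R : List (Item d)) :
    Multiset (Item d) :=
  R.foldl (fun A e => if GreedyAccepts g P A e then e ::ₘ A else A) 0

/-- The online algorithm for `n` items and the curve `C`: it draws `k ~ Binomial(n, 1/2)`, rejects
the first `k` items, learns a classifier from them, and then accepts the remaining items that pass
the filter and do not decrease the profit of the current solution. -/
def classifierAlgorithm {d : ℕ} (g : (Fin d → ℝ) → ℝ) (C : Set (Fin d → ℝ)) (n : ℕ) :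
    RandomizedOnlineAlgorithm d where
  Seed := ℕ
  measurableSpace := inferInstance
  law := ProbabilityTheory.binomial n ⟨1 / 2, by norm_num, by norm_num⟩
  isProbabilityMeasure := inferInstance
  accept k past e := k ≤ past.length ∧
    GreedyAccepts g (PassesFilter g C (past.take k))
      (greedySolution g (PassesFilter g C (past.take k)) (past.drop k)) e
  measurableSet_accept _ _ := MeasurableSet.of_discrete

end

/-! ### Increasing differences, marginal duals, and balanced curves. -/

noncomputable section

/-! ### Convex supermodular costs -/

namespace IsRegularSupermodularCost

variable {d : ℕ} {g : (Fin d → ℝ) → ℝ}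

/-! Convexity and supermodularity together give `g` increasing differences, hence superadditivity.
Consider prices `l` at which every marginal dual equals `G`. Superadditivity bounds `⟨l, z⟩ - g z`
by the sum of the marginal duals, which is `d * G` (`dotProduct_sub_le`). Conversely, if the top of
a box does not maximize this concave function on the box, then a maximizer has slack in some
coordinate, and moving it towards that axis shows that its value is at least `G`
(`exists_marginalDual_le`). The ratio between `d * G` and `G` is the source of the factor `d`.

Two facts follow. The items picked by `l` have fractional optimum at least `min (fopt - d * G) G`
(`min_le_fracOpt_pickedSet`). A greedy run on small items picked by `l` either takes all of them,
which is then fractionally optimal, or ends with profit nearly `G` (`greedySolution_dichotomy`).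

Let the sample have fractional optimum `f`. The point of the curve with common dual `f / (2 * d)` is
a candidate, so everything passing the learned filter is picked by it and the greedy dichotomy
applies. To see that enough passes, fix in advance the set `W` of items that pass for every
classifier good for the whole instance, with a constant factor of slack. If the sample carries a
quarter of the optimum, its candidates are all good in this sense, so `W` passes. Monotonicity of
the curve shows that `W` is valuable. The part of `W` outside the sample keeps a quarter of its
value with high probability: the fractional optimum splits into small shares that bound the optimum
of every subset from below, and Chebyshev's inequality applies to their sum.

For arbitrary instances, an optimal solution has at most `d` exceptional items, because each exceeds
all the others together in some coordinate. Either single-item profits are small compared with the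
optimum of the non-exceptional items, and the filter restricted to these works, or a best single
item is worth a `1 / d` fraction of `opt` up to a constant, and a secretary rule finds it. A random
choice between the rules covers both cases. -/

lemma continuousOn (hg : IsRegularSupermodularCost g) : ContinuousOn g (Ici 0) :=
  hg.differentiable.continuousOn

lemma convexOn (hg : IsRegularSupermodularCost g) : ConvexOn ℝ (Ici 0) g :=
  hg.strictConvex.convexOn

/-- Both inner points lie on the segment from `z` to `z + (t + u) • h` with complementary weights,
so the two convexity inequalities add up. -/
lemma ray_increments (hg : IsRegularSupermodularCost g) {z h : Fin d → ℝ} (hz : 0 ≤ z)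
    (hh : 0 ≤ h) {t u : ℝ} (ht : 0 ≤ t) (hu : 0 ≤ u) :
    g (z + t • h) + g (z + u • h) ≤ g z + g (z + (t + u) • h) := by
  rcases (add_nonneg ht hu).eq_or_lt with h0 | h0
  · obtain rfl : t = 0 := by linarith
    obtain rfl : u = 0 := by linarith
    simp
  have hz' : (0 : Fin d → ℝ) ≤ z + (t + u) • h := add_nonneg hz (smul_nonneg h0.le hh)
  have key : ∀ {p q : ℝ}, 0 ≤ p → 0 ≤ q → p + q = t + u →
      g (z + p • h) ≤ q / (t + u) * g z + p / (t + u) * g (z + (t + u) • h) := by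
    intro p q hp hq hpq
    have := hg.convexOn.2 hz hz' (div_nonneg hq h0.le) (div_nonneg hp h0.le)
      (by rw [← add_div, add_comm, hpq, div_self h0.ne'])
    have e : (q / (t + u)) • z + (p / (t + u)) • (z + (t + u) • h) = z + p • h := by
      ext i
      simp only [Pi.add_apply, Pi.smul_apply, smul_eq_mul]
      field_simp
      rw [← hpq]; ring
    rwa [e] at this
  have h1 := key ht hu rfl
  have h2 := key hu ht (add_comm u t)
  have h3 : u / (t + u) + t / (t + u) = 1 := by rw [← add_div, add_comm, div_self h0.ne']
  have : g z + g (z + (t + u) • h) = (u / (t + u) + t / (t + u)) * g z +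
      (u / (t + u) + t / (t + u)) * g (z + (t + u) • h) := by rw [h3]; ring
  rw [this]; linarith

/-- The base point moves from `a` to `b` in two stages. Changing the coordinates other than `i` is
handled by supermodularity, and changing coordinate `i` itself by convexity along the axis. -/
lemma single_increments (hg : IsRegularSupermodularCost g) {a b : Fin d → ℝ} (ha : 0 ≤ a)
    (hab : a ≤ b) (i : Fin d) {t : ℝ} (ht : 0 ≤ t) :
    g (a + Pi.single i t) - g a ≤ g (b + Pi.single i t) - g b := by
  set c : Fin d → ℝ := Function.update b i (a i) with hc
  have hac : a ≤ c := by
    intro j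
    rcases eq_or_ne j i with rfl | h
    · simp [hc]
    · simpa [hc, h] using hab j
  have hsingle : (0 : Fin d → ℝ) ≤ Pi.single i t := by simpa using ht
  have h1 := hg.supermodular (a + Pi.single i t) c (add_nonneg ha hsingle) (ha.trans hac)
  have e1 : (a + Pi.single i t) ⊓ c = a := by
    ext j
    rcases eq_or_ne j i with rfl | h
    · simp [hc, ht]
    · simpa [hc, h] using hab j
  have e2 : (a + Pi.single i t) ⊔ c = c + Pi.single i t := by
    ext j
    rcases eq_or_ne j i with rfl | h
    · simp [hc, ht]
    · simpa [hc, h] using hab j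
  rw [e1, e2] at h1
  have h2 := hg.ray_increments (z := c) (h := Pi.single i 1) (ha.trans hac) (by simp) ht
    (sub_nonneg.2 (hab i))
  have e3 : c + t • Pi.single i (1 : ℝ) = c + Pi.single i t := by
    rw [← Pi.single_smul]; simp
  have e4 : c + (b i - a i) • Pi.single i (1 : ℝ) = b := by
    ext j
    rcases eq_or_ne j i with rfl | h
    · simp [hc]
    · simp [hc, h]
  have e5 : c + (t + (b i - a i)) • Pi.single i (1 : ℝ) = b + Pi.single i t := by
    rw [add_smul, add_comm (t • _), ← add_assoc, e4, ← Pi.single_smul]; simp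
  rw [e3, e4, e5] at h2
  linarith

/-- A convex supermodular function has increasing differences. -/
lemma increments (hg : IsRegularSupermodularCost g) {a b h : Fin d → ℝ} (ha : 0 ≤ a)
    (hab : a ≤ b) (hh : 0 ≤ h) : g (a + h) - g a ≤ g (b + h) - g b := by
  -- The increment `h` is added one coordinate at a time, and the base points move along with it.
  suffices H : ∀ s : Finset (Fin d), ∀ a b : Fin d → ℝ, 0 ≤ a → a ≤ b →
      g (a + ∑ i ∈ s, Pi.single i (h i)) - g a ≤ g (b + ∑ i ∈ s, Pi.single i (h i)) - g b by
    simpa [Finset.univ_sum_single] using H Finset.univ a b ha hab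
  intro s
  induction s using Finset.induction_on with
  | empty => simp
  | insert i s his ih =>
    intro a b ha hab
    rw [Finset.sum_insert his, ← add_assoc, ← add_assoc]
    have hs : (0 : Fin d → ℝ) ≤ Pi.single i (h i) := by simpa using hh i
    have h1 := hg.single_increments ha hab i (hh i)
    have h2 := ih (a + Pi.single i (h i)) (b + Pi.single i (h i)) (add_nonneg ha hs)
      (add_le_add_left hab _)
    linarith

lemma superadditive (hg : IsRegularSupermodularCost g) {a b : Fin d → ℝ} (ha : 0 ≤ a)
    (hb : 0 ≤ b) : g a + g b ≤ g (a + b) := by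
  have := hg.increments le_rfl ha hb
  rw [zero_add, hg.map_zero] at this
  linarith

lemma monotone (hg : IsRegularSupermodularCost g) {a b : Fin d → ℝ} (ha : 0 ≤ a) (hab : a ≤ b) :
    g a ≤ g b := by
  have := hg.superadditive ha (sub_nonneg.2 hab)
  have h2 := hg.nonneg _ (sub_nonneg.2 hab)
  rw [add_sub_cancel] at this
  linarith

lemma sum_single_le (hg : IsRegularSupermodularCost g) {z : Fin d → ℝ} (hz : 0 ≤ z) :
    ∑ i, g (Pi.single i (z i)) ≤ g z := by
  suffices H : ∀ s : Finset (Fin d), ∑ i ∈ s, g (Pi.single i (z i)) ≤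
      g (∑ i ∈ s, Pi.single i (z i)) by
    simpa [Finset.univ_sum_single] using H Finset.univ
  intro s
  induction s using Finset.induction_on with
  | empty => simp [hg.map_zero]
  | insert i s his ih =>
    rw [Finset.sum_insert his, Finset.sum_insert his]
    have := hg.superadditive (a := Pi.single i (z i)) (b := ∑ i ∈ s, Pi.single i (z i))
      (by simpa using hz i) (Finset.sum_nonneg fun j _ => by simpa using hz j)
    linarith

/-! ### Duals of the marginal functions -/

/-- Growth of the gradient gives a point `t₀` on the axis with slope at least `l`. Beyond it,
convexity keeps the cost above a line of slope `l`; before it, `|l| * t₀` is a bound. Boundedness is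
what makes the real `sSup` in `marginalDual` a genuine supremum. -/
lemma bddAbove_marginal (hg : IsRegularSupermodularCost g) (i : Fin d) (l : ℝ) :
    BddAbove ((fun x : ℝ => l * x - g (Pi.single i x)) '' Ici 0) := by
  set e : Fin d → ℝ := Pi.single i 1 with he
  have hsm : ∀ t : ℝ, Pi.single i t = t • e := fun t => by rw [he, ← Pi.single_smul]; simp
  have he0 : (0 : Fin d → ℝ) ≤ e := by simp [he]
  have hne : e ≠ 0 := by simp [he]
  obtain ⟨t₀, h₀, ht₀⟩ := (((hg.gradient_tendsto e he0 hne).eventually_ge_atTop l).and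
    (eventually_gt_atTop 0)).exists
  have hmem : ∀ t : ℝ, 0 ≤ t → t • e ∈ Ici (0 : Fin d → ℝ) := fun t ht => smul_nonneg ht he0
  set f : ℝ → ℝ := fun t => g (t • e) with hf
  have hconv : ConvexOn ℝ (Ici (0 : ℝ)) f := by
    refine ⟨convex_Ici 0, fun x hx y hy a b ha hb hab => ?_⟩
    have := hg.convexOn.2 (hmem x hx) (hmem y hy) ha hb hab
    simpa [hf, smul_smul, add_smul] using this
  have hderiv : HasDerivWithinAt f (fderivWithin ℝ g (Ici 0) (t₀ • e) e) (Ici 0) t₀ := by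
    have h1 : HasFDerivWithinAt g (fderivWithin ℝ g (Ici 0) (t₀ • e)) (Ici 0) (t₀ • e) :=
      (hg.differentiable _ (hmem t₀ ht₀.le)).hasFDerivWithinAt
    have h2 : HasDerivWithinAt (fun t : ℝ => t • e) e (Ici 0) t₀ := by
      simpa using ((hasDerivAt_id t₀).smul_const e).hasDerivWithinAt
    exact h1.comp_hasDerivWithinAt t₀ h2 (fun t ht => hmem t ht)
  have hderiv' : HasDerivAt f (fderivWithin ℝ g (Ici 0) (t₀ • e) e) t₀ :=
    hderiv.hasDerivAt (Ici_mem_nhds ht₀)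
  have htan : ∀ t, t₀ ≤ t → f t₀ + l * (t - t₀) ≤ f t := by
    intro t ht
    rcases ht.eq_or_lt with rfl | hlt
    · simp
    have := hconv.le_slope_of_hasDerivAt (mem_Ici.2 ht₀.le) (mem_Ici.2 (ht₀.le.trans ht)) hlt hderiv'
    rw [slope_def_field, le_div_iff₀ (sub_pos.2 hlt)] at this
    nlinarith [mul_le_mul_of_nonneg_right h₀ (sub_pos.2 hlt).le]
  refine ⟨|l| * t₀, ?_⟩
  rintro _ ⟨x, hx, rfl⟩
  have hx : 0 ≤ x := hx
  simp only
  rw [hsm x]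
  have hg0 := hg.nonneg _ (hmem t₀ ht₀.le)
  have hgx := hg.nonneg _ (hmem x hx)
  have hl := le_abs_self l
  rcases le_total x t₀ with h | h
  · nlinarith [mul_le_mul_of_nonneg_right hl hx, mul_le_mul_of_nonneg_left h (abs_nonneg l)]
  · have := htan x h
    simp only [hf] at this
    nlinarith [mul_le_mul_of_nonneg_right hl ht₀.le]

lemma le_marginalDual (hg : IsRegularSupermodularCost g) (i : Fin d) (l : ℝ) {x : ℝ} (hx : 0 ≤ x) :
    l * x - g (Pi.single i x) ≤ marginalDual g i l :=
  le_csSup (hg.bddAbove_marginal i l) ⟨x, hx, rfl⟩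

lemma marginalDual_le {i : Fin d} {l c : ℝ}
    (h : ∀ x : ℝ, 0 ≤ x → l * x - g (Pi.single i x) ≤ c) : marginalDual g i l ≤ c := by
  refine csSup_le (nonempty_Ici.image _) ?_
  rintro _ ⟨x, hx, rfl⟩
  exact h x hx

lemma marginalDual_nonneg (hg : IsRegularSupermodularCost g) (i : Fin d) (l : ℝ) :
    0 ≤ marginalDual g i l := by
  simpa [hg.map_zero] using hg.le_marginalDual i l le_rfl

lemma marginalDual_zero (hg : IsRegularSupermodularCost g) (i : Fin d) :
    marginalDual g i 0 = 0 := by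
  refine le_antisymm (marginalDual_le fun x hx => ?_) (hg.marginalDual_nonneg i 0)
  have := hg.nonneg (Pi.single i x) (by simpa using hx)
  linarith

lemma marginalDual_mono (hg : IsRegularSupermodularCost g) (i : Fin d) :
    Monotone (marginalDual g i) := by
  intro l m hlm
  refine marginalDual_le fun x hx => ?_
  have := hg.le_marginalDual i m hx
  nlinarith [mul_le_mul_of_nonneg_right hlm hx]

lemma convexOn_marginalDual (hg : IsRegularSupermodularCost g) (i : Fin d) :
    ConvexOn ℝ univ (marginalDual g i) := by
  refine ⟨convex_univ, fun l _ m _ a b ha hb hab => marginalDual_le fun x hx => ?_⟩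
  have h1 := mul_le_mul_of_nonneg_left (hg.le_marginalDual i l hx) ha
  have h2 := mul_le_mul_of_nonneg_left (hg.le_marginalDual i m hx) hb
  simp only [smul_eq_mul]
  have : g (Pi.single i x) = (a + b) * g (Pi.single i x) := by rw [hab, one_mul]
  rw [this]
  linarith

lemma continuous_marginalDual (hg : IsRegularSupermodularCost g) (i : Fin d) :
    Continuous (marginalDual g i) :=
  continuousOn_univ.1 ((hg.convexOn_marginalDual i).continuousOn isOpen_univ)

lemma tendsto_marginalDual (hg : IsRegularSupermodularCost g) (i : Fin d) :
    Tendsto (marginalDual g i) atTop atTop := by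
  refine tendsto_atTop_mono (f := fun l => l - g (Pi.single i 1)) (fun l => ?_)
    (tendsto_atTop_add_const_right _ _ tendsto_id)
  simpa using hg.le_marginalDual i l zero_le_one

/-- Supermodularity bounds the convex dual by the sum of the marginal duals. -/
lemma dotProduct_sub_le (hg : IsRegularSupermodularCost g) (l : Fin d → ℝ) {z : Fin d → ℝ}
    (hz : 0 ≤ z) : l ⬝ᵥ z - g z ≤ ∑ i, marginalDual g i (l i) := by
  have h1 := hg.sum_single_le hz
  have h2 := Finset.sum_le_sum fun i (_ : i ∈ Finset.univ) => hg.le_marginalDual i (l i) (hz i)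
  rw [Finset.sum_sub_distrib] at h2
  rw [dotProduct]
  linarith

/-! ### Maximal points of boxes -/

/-- The top of the box `[0, T]` maximizes `⟨l, z⟩ - g z` over the box. -/
def _root_.IsBoxMax (g : (Fin d → ℝ) → ℝ) (l T : Fin d → ℝ) : Prop :=
  ∀ z, 0 ≤ z → z ≤ T → l ⬝ᵥ z - g z ≤ l ⬝ᵥ T - g T

/-- If the top of a box is not optimal for the prices `l`, then some coordinate is not used up at
an optimum, whose value is thus at least the corresponding marginal dual. -/
lemma exists_marginalDual_le (hg : IsRegularSupermodularCost g) {l T : Fin d → ℝ} (hT : 0 ≤ T)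
    (h : ¬ IsBoxMax g l T) :
    ∃ z, 0 ≤ z ∧ z ≤ T ∧ ∃ i, marginalDual g i (l i) ≤ l ⬝ᵥ z - g z := by
  obtain ⟨z, ⟨hz0, hzT⟩, hmax⟩ := (isCompact_Icc (a := (0 : Fin d → ℝ)) (b := T)).exists_isMaxOn
    ⟨0, le_rfl, hT⟩ (f := fun z => l ⬝ᵥ z - g z) (by
      refine ContinuousOn.sub (Continuous.continuousOn ?_)
        (hg.continuousOn.mono fun x hx => hx.1)
      fun_prop)
  have hzne : ∃ i, z i < T i := by
    by_contra! hcon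
    obtain rfl : z = T := le_antisymm hzT hcon
    exact h fun y hy hyT => hmax ⟨hy, hyT⟩
  obtain ⟨i, hi⟩ := hzne
  refine ⟨z, hz0, hzT, i, marginalDual_le fun x hx => ?_⟩
  have hx1 : 0 < 1 + x := by linarith
  -- The slack in coordinate `i` leaves room for a small step from `z` towards `x eᵢ` within the
  -- box. Since `z` is optimal and the objective is concave, the value at `x eᵢ` cannot exceed that
  -- at `z`. Dividing by `1 + x` also covers `x = 0`.
  obtain ⟨η, hη0, hη1, hηT⟩ : ∃ η : ℝ, 0 < η ∧ η < 1 ∧ η * x ≤ T i - z i := by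
    refine ⟨min (1 / 2) ((T i - z i) / (1 + x)), lt_min (by norm_num)
      (div_pos (by linarith) hx1), (min_le_left _ _).trans_lt (by norm_num), ?_⟩
    calc _ ≤ (T i - z i) / (1 + x) * x := mul_le_mul_of_nonneg_right (min_le_right _ _) hx
      _ ≤ (T i - z i) / (1 + x) * (1 + x) := by
        refine mul_le_mul_of_nonneg_left (by linarith) (div_nonneg (by linarith) hx1.le)
      _ = _ := div_mul_cancel₀ _ hx1.ne'
  have hxs : (0 : Fin d → ℝ) ≤ Pi.single i x := by simpa using hx
  set w : Fin d → ℝ := (1 - η) • z + η • Pi.single i x with hw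
  have hw0 : 0 ≤ w := add_nonneg (smul_nonneg (by linarith) hz0) (smul_nonneg hη0.le hxs)
  have hwT : w ≤ T := by
    intro j
    have hzj := hz0 j
    have hTj := hzT j
    simp only [Pi.zero_apply] at hzj
    rcases eq_or_ne j i with rfl | hj
    · simp only [hw, Pi.add_apply, Pi.smul_apply, smul_eq_mul, Pi.single_eq_same]
      nlinarith
    · simp only [hw, Pi.add_apply, Pi.smul_apply, smul_eq_mul, Pi.single_eq_of_ne hj]
      nlinarith
  have h1 : l ⬝ᵥ w - g w ≤ l ⬝ᵥ z - g z := hmax ⟨hw0, hwT⟩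
  have h2 := hg.convexOn.2 hz0 hxs (sub_nonneg.2 hη1.le) hη0.le
    (sub_add_cancel 1 η)
  have h3 : l ⬝ᵥ w = (1 - η) * l ⬝ᵥ z + η * (l i * x) := by
    simp [hw, dotProduct_add, dotProduct_smul]
  simp only [smul_eq_mul, ← hw] at h2
  rw [h3] at h1
  have : η * (l i * x - g (Pi.single i x)) ≤ η * (l ⬝ᵥ z - g z) := by linarith
  exact le_of_mul_le_mul_left this hη0

/-- Moving from an optimal box top `S` to a non-optimal one `S + s`, one passes points of value
arbitrarily close to `G`, if `G` is a lower bound for the marginal duals. -/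
lemma exists_on_segment (hg : IsRegularSupermodularCost g) {l S s : Fin d → ℝ} (hl : 0 ≤ l)
    (hS : 0 ≤ S) (hs : 0 ≤ s) (h0 : IsBoxMax g l S) (h1 : ¬ IsBoxMax g l (S + s)) {G : ℝ}
    (hG : ∀ i, G ≤ marginalDual g i (l i)) {δ : ℝ} (hδ : 0 < δ) :
    ∃ θ ∈ Icc (0 : ℝ) 1, G - δ ≤ l ⬝ᵥ (S + θ • s) - g (S + θ • s) := by
  -- The segment is cut into `N` steps, each worth less than `δ` at prices `l`. Some step leads from
  -- an optimal box top `y` to a non-optimal one.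
  obtain ⟨N, hN⟩ := exists_nat_gt ((l ⬝ᵥ s) / δ)
  have hls : 0 ≤ l ⬝ᵥ s := dotProduct_nonneg_of_nonneg hl hs
  have hN0 : (0 : ℝ) < N := (div_nonneg hls hδ.le).trans_lt hN
  have hstep : ∃ k, k < N ∧ IsBoxMax g l (S + ((k : ℝ) / N) • s) ∧
      ¬ IsBoxMax g l (S + (((k + 1 : ℕ) : ℝ) / N) • s) := by
    by_contra! hcon
    have : ∀ k, k ≤ N → IsBoxMax g l (S + ((k : ℝ) / N) • s) := by
      intro k
      induction k with
      | zero => simpa using h0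
      | succ k ih => exact fun hk => hcon k hk (ih (by omega))
    apply h1
    simpa [hN0.ne'] using this N le_rfl
  obtain ⟨k, hk, hk1, hk2⟩ := hstep
  have hkN : (k : ℝ) + 1 ≤ N := by exact_mod_cast hk
  have hsm : ∀ t : ℝ, 0 ≤ t → (0 : Fin d → ℝ) ≤ S + t • s :=
    fun t ht => add_nonneg hS (smul_nonneg ht hs)
  refine ⟨k / N, ⟨by positivity, (div_le_one hN0).2 (by linarith)⟩, ?_⟩
  set y := S + ((k : ℝ) / N) • s with hy
  -- The optimum `z` of the larger box has value at least `G`. Cutting it down to `z ⊓ y` loses at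
  -- most one step's worth, and `y` is at least as good as `z ⊓ y`.
  obtain ⟨z, hz0, hzT, i, hi⟩ := hg.exists_marginalDual_le (hsm _ (by positivity)) hk2
  have hyz : (0 : Fin d → ℝ) ≤ z ⊓ y := le_inf hz0 (hsm _ (by positivity))
  have h3 := hk1 (z ⊓ y) hyz inf_le_right
  have h4 := hg.monotone hyz inf_le_left
  have h5 : z ≤ z ⊓ y + (1 / (N : ℝ)) • s := by
    intro j
    have e1 := hzT j
    have e2 := hs j
    simp only [hy, Pi.add_apply, Pi.smul_apply, smul_eq_mul, Nat.cast_add, Nat.cast_one, add_div,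
      Pi.zero_apply, Pi.inf_apply] at *
    have e3 : 0 ≤ 1 / (N : ℝ) * s j := by positivity
    rcases le_total (z j) (S j + k / N * s j) with h | h
    · rw [inf_eq_left.2 h]; linarith
    · rw [inf_eq_right.2 h]; linarith
  have h6 : l ⬝ᵥ z ≤ l ⬝ᵥ (z ⊓ y) + 1 / N * l ⬝ᵥ s := by
    have := dotProduct_le_dotProduct_of_nonneg_left h5 hl
    rwa [dotProduct_add, dotProduct_smul, smul_eq_mul] at this
  have h7 : 1 / N * l ⬝ᵥ s ≤ δ := by
    rw [div_lt_iff₀ hδ] at hN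
    rw [one_div, inv_mul_le_iff₀ hN0]; linarith
  linarith [hG i]

/-! ### Existence of balanced curves -/

/-- The dual is convex and vanishes at `0`, so its value at `l` is at most `l / m` times its value
at `m`. -/
lemma marginalDual_lt (hg : IsRegularSupermodularCost g) (i : Fin d) {l m : ℝ} (hl : 0 ≤ l)
    (hlm : l < m) (h : 0 < marginalDual g i m) : marginalDual g i l < marginalDual g i m := by
  have hm : 0 < m := hl.trans_lt hlm
  have := (hg.convexOn_marginalDual i).2 (mem_univ 0) (mem_univ m)
    (sub_nonneg.2 ((div_le_one hm).2 hlm.le)) (div_nonneg hl hm.le) (sub_add_cancel 1 _)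
  simp only [smul_eq_mul, mul_zero, zero_add, hg.marginalDual_zero, div_mul_cancel₀ _ hm.ne'] at this
  exact this.trans_lt (mul_lt_of_lt_one_left h ((div_lt_one hm).2 hlm))

/-- The marginal dual has a monotone continuous right inverse, on a flat initial segment followed
by the region of strict growth. -/
lemma exists_marginal_curve (hg : IsRegularSupermodularCost g) (i : Fin d) :
    ∃ γ : NNReal → ℝ, Continuous γ ∧ Monotone γ ∧ γ 0 = 0 ∧ Tendsto γ atTop atTop ∧
      ∀ t, marginalDual g i (γ t) = max ((t : ℝ) - 1) 0 := by
  set ψ := marginalDual g i with hψ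
  have hcont : Continuous ψ := hg.continuous_marginalDual i
  obtain ⟨a, ⟨ha0, haψ⟩, hamax⟩ : ∃ a, IsGreatest {l | 0 ≤ l ∧ ψ l = 0} a := by
    have hclosed : IsClosed {l | 0 ≤ l ∧ ψ l = 0} :=
      (isClosed_le continuous_const continuous_id).inter (isClosed_eq hcont continuous_const)
    obtain ⟨b, hb⟩ := ((hg.tendsto_marginalDual i).eventually_gt_atTop 0).exists
    have hbdd : {l | 0 ≤ l ∧ ψ l = 0} ⊆ Icc 0 b := by
      intro l hl
      refine ⟨hl.1, le_of_not_gt fun h => ?_⟩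
      have := hg.marginalDual_mono i h.le
      have h2 := hl.2
      simp only [hψ] at h2
      linarith
    exact (isCompact_Icc.of_isClosed_subset hclosed hbdd).exists_isGreatest
      ⟨0, le_rfl, hg.marginalDual_zero i⟩
  have hpos : ∀ l, a < l → 0 < ψ l := by
    intro l hl
    refine lt_of_le_of_ne (hg.marginalDual_nonneg i l) fun h => ?_
    exact hl.not_ge (hamax ⟨ha0.trans hl.le, h.symm⟩)
  -- Beyond its last zero `a` the dual increases strictly. Continuing it by the identity on the
  -- negative axis gives an increasing bijection of the whole line, whose inverse is automatically
  -- continuous.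
  set f : ℝ → ℝ := fun x => ψ (a + max x 0) + min x 0 with hf
  have hfcont : Continuous f := by
    simp only [hf]; fun_prop
  have hfmono : StrictMono f := by
    intro x y hxy
    simp only [hf]
    rcases le_or_gt y 0 with hy | hy
    · rw [max_eq_right hy, max_eq_right (hxy.le.trans hy), min_eq_left hy,
        min_eq_left (hxy.le.trans hy)]
      linarith
    · have h1 : ψ (a + max x 0) < ψ (a + max y 0) := by
        refine hg.marginalDual_lt i (add_nonneg ha0 (le_max_right _ _)) ?_ (hpos _ ?_)
        · have : max x 0 < max y 0 := by simp [hxy, hy]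
          linarith
        · simp [hy]
      have h2 : min x 0 ≤ min y 0 := min_le_min_right _ hxy.le
      linarith
  have hfsurj : Function.Surjective f := by
    refine hfcont.surjective ?_ ?_
    · refine tendsto_atTop_mono' _ ?_ ((hg.tendsto_marginalDual i).comp
        (tendsto_atTop_add_const_left _ a tendsto_id))
      filter_upwards [eventually_ge_atTop 0] with x hx
      simp [hf, hx, hψ]
    · refine (tendsto_congr' ?_).2 tendsto_id
      filter_upwards [eventually_le_atBot 0] with x hx
      simp [hf, hx, haψ]
  set F := hfmono.orderIsoOfSurjective f hfsurj with hF
  have hFf : ∀ u, f (F.symm u) = u := fun u => F.apply_symm_apply u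
  have hf0 : f 0 = 0 := by simp [hf, haψ]
  have hF0 : F.symm 0 = 0 := by
    rw [F.symm_apply_eq]; exact hf0.symm
  -- One unit of time is spent crossing the flat segment `[0, a]`; afterwards the dual grows at unit
  -- speed.
  refine ⟨fun t => a * min (t : ℝ) 1 + F.symm (max ((t : ℝ) - 1) 0), ?_, ?_, ?_, ?_, ?_⟩
  · have := F.symm.continuous
    fun_prop
  · intro s t hst
    have hst' : (s : ℝ) ≤ t := hst
    refine add_le_add (mul_le_mul_of_nonneg_left (min_le_min_right _ hst') ha0)
      (F.symm.monotone (max_le_max_right _ (by linarith)))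
  · simp [hF0]
  · have h1 : Tendsto (fun t : NNReal => F.symm (max ((t : ℝ) - 1) 0)) atTop atTop := by
      refine F.symm.tendsto_atTop.comp (tendsto_atTop_mono (fun t => le_max_left _ _) ?_)
      exact tendsto_atTop_add_const_right _ _ (NNReal.tendsto_coe_atTop.2 tendsto_id)
    refine tendsto_atTop_mono (fun t => ?_) h1
    have : 0 ≤ a * min (t : ℝ) 1 := mul_nonneg ha0 (le_min t.2 zero_le_one)
    linarith
  · intro t
    have hu : 0 ≤ max ((t : ℝ) - 1) 0 := le_max_right _ _
    have h0 : 0 ≤ F.symm (max ((t : ℝ) - 1) 0) := by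
      exact hF0.ge.trans (F.symm.monotone hu)
    have h1 := hFf (max ((t : ℝ) - 1) 0)
    simp only [hf, max_eq_left h0, min_eq_right h0, add_zero] at h1
    rcases le_total (t : ℝ) 1 with h | h
    · simp only [max_eq_right (sub_nonpos.2 h), hF0, add_zero]
      refine le_antisymm ?_ (hg.marginalDual_nonneg i _)
      refine (hg.marginalDual_mono i ?_).trans haψ.le
      rw [min_eq_left h]
      exact mul_le_of_le_one_right ha0 h
    · simpa only [min_eq_right h, mul_one] using h1

/-- The flat segments of the marginals differ, but every coordinate has dual `max (t - 1) 0` at time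
`t`, so running all coordinates on the same clock is balanced. -/
lemma exists_isBalancedCurve (hg : IsRegularSupermodularCost g) : ∃ C, IsBalancedCurve g C := by
  choose γ h1 h2 h3 h4 h5 using hg.exists_marginal_curve
  refine ⟨_, fun t i => γ i t, continuous_pi h1, fun s t hst i => h2 i hst, funext h3, h4, ?_, rfl⟩
  intro t i j
  rw [h5, h5]

/-- A balanced curve has a point at which all the marginal duals take a prescribed value. -/
lemma _root_.IsBalancedCurve.exists_marginalDual_eq (hg : IsRegularSupermodularCost g)
    {C : Set (Fin d → ℝ)} (hC : IsBalancedCurve g C) {G : ℝ} (hG : 0 ≤ G) :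
    ∃ l ∈ C, 0 ≤ l ∧ ∀ i, marginalDual g i (l i) = G := by
  obtain ⟨γ, hcont, hmono, h0, htop, hbal, rfl⟩ := hC
  rcases isEmpty_or_nonempty (Fin d) with hd | ⟨⟨i⟩⟩
  · exact ⟨γ 0, ⟨0, rfl⟩, h0.ge, fun i => (hd.false i).elim⟩
  have hc : Continuous fun t => marginalDual g i (γ t i) :=
    (hg.continuous_marginalDual i).comp ((continuous_apply i).comp hcont)
  obtain ⟨T, hT⟩ := (((hg.tendsto_marginalDual i).comp (htop i)).eventually_ge_atTop G).exists
  obtain ⟨t, -, ht⟩ := intermediate_value_Icc (zero_le : 0 ≤ T) hc.continuousOn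
    (show G ∈ Icc _ _ from ⟨by simpa [h0, hg.marginalDual_zero] using hG, hT⟩)
  refine ⟨γ t, ⟨t, rfl⟩, ?_, fun j => (hbal t j i).trans ht⟩
  rw [← h0]
  exact hmono zero_le

end IsRegularSupermodularCost

end

/-! ### Fractional optima, price-picked sets, and greedy solutions. -/

noncomputable section

/-! ### Fractional optima of finite sets of items -/

variable {d : ℕ} {g : (Fin d → ℝ) → ℝ} {ι : Type*}

/-- The profit of the fractional solution `x`, restricted to the items in `A`. -/
def fracValue (g : (Fin d → ℝ) → ℝ) (items : ι → Item d) (A : Finset ι) (x : ι → ℝ) : ℝ :=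
  ∑ i ∈ A, x i * (items i).value - g (∑ i ∈ A, x i • (items i).size)

/-- The fractional optimum of the items in `A`. -/
def fracOpt (g : (Fin d → ℝ) → ℝ) (items : ι → Item d) (A : Finset ι) : ℝ :=
  sSup (fracValue g items A '' Icc 0 1)

/-- The items of `A` picked by the classifier `l`. -/
def pickedSet (items : ι → Item d) (l : Fin d → ℝ) (A : Finset ι) : Finset ι :=
  A.filter fun i => l ⬝ᵥ (items i).size ≤ (items i).value

lemma fracSize_nonneg (items : ι → Item d) (A : Finset ι) {x : ι → ℝ} (hx : 0 ≤ x) :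
    0 ≤ ∑ i ∈ A, x i • (items i).size :=
  Finset.sum_nonneg fun i _ => smul_nonneg (hx i) (items i).size_nonneg

lemma fracValue_restrict (items : ι → Item d) {A B : Finset ι} (h : A ⊆ B) (x : ι → ℝ) :
    fracValue g items B (fun i => if i ∈ A then x i else 0) = fracValue g items A x := by
  simp only [fracValue, ite_mul, zero_mul, ite_smul, zero_smul, Finset.sum_ite_mem,
    Finset.inter_eq_right.2 h]

lemma restrict_mem_Icc (A : Finset ι) {x : ι → ℝ} (hx : x ∈ Icc (0 : ι → ℝ) 1) :
    (fun i => if i ∈ A then x i else 0) ∈ Icc (0 : ι → ℝ) 1 := by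
  constructor <;> intro i <;> by_cases h : i ∈ A <;> simp [h]
  · exact hx.1 i
  · exact hx.2 i

lemma fracOpt_le {items : ι → Item d} {A : Finset ι} {c : ℝ}
    (h : ∀ x ∈ Icc (0 : ι → ℝ) 1, fracValue g items A x ≤ c) : fracOpt g items A ≤ c := by
  refine csSup_le (Nonempty.image _ ⟨0, le_rfl, zero_le_one⟩) ?_
  rintro _ ⟨x, hx, rfl⟩
  exact h x hx

namespace IsRegularSupermodularCost

lemma le_fracOpt (hg : IsRegularSupermodularCost g) (items : ι → Item d) (A : Finset ι)
    {x : ι → ℝ} (hx : x ∈ Icc (0 : ι → ℝ) 1) : fracValue g items A x ≤ fracOpt g items A := by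
  refine le_csSup ⟨∑ i ∈ A, (items i).value, ?_⟩ ⟨x, hx, rfl⟩
  rintro _ ⟨y, hy, rfl⟩
  have h1 := hg.nonneg _ (fracSize_nonneg items A hy.1)
  have h2 : ∑ i ∈ A, y i * (items i).value ≤ ∑ i ∈ A, (items i).value :=
    Finset.sum_le_sum fun i _ => mul_le_of_le_one_left (items i).value_nonneg (hy.2 i)
  rw [fracValue]
  linarith

lemma fracOpt_nonneg (hg : IsRegularSupermodularCost g) (items : ι → Item d) (A : Finset ι) :
    0 ≤ fracOpt g items A := by
  have := hg.le_fracOpt items A (x := 0) ⟨le_rfl, zero_le_one⟩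
  simpa [fracValue, hg.map_zero] using this

lemma fracOpt_mono (hg : IsRegularSupermodularCost g) (items : ι → Item d) {A B : Finset ι}
    (h : A ⊆ B) : fracOpt g items A ≤ fracOpt g items B :=
  fracOpt_le fun x hx => by
    rw [← fracValue_restrict items h]
    exact hg.le_fracOpt items B (restrict_mem_Icc A hx)

lemma fracOpt_union_le [DecidableEq ι] (hg : IsRegularSupermodularCost g) (items : ι → Item d)
    (A B : Finset ι) : fracOpt g items (A ∪ B) ≤ fracOpt g items A + fracOpt g items B := by
  refine fracOpt_le fun x hx => ?_
  have h1 := hg.le_fracOpt items A hx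
  have h2 := hg.le_fracOpt items (B \ A) hx
  have h3 := hg.fracOpt_mono items (Finset.sdiff_subset : B \ A ⊆ B)
  have h4 := hg.superadditive (fracSize_nonneg items A hx.1) (fracSize_nonneg items (B \ A) hx.1)
  rw [← Finset.union_sdiff_self_eq_union]
  simp only [fracValue] at *
  rw [Finset.sum_union Finset.disjoint_sdiff, Finset.sum_union Finset.disjoint_sdiff]
  linarith

lemma exists_fracOpt_eq (hg : IsRegularSupermodularCost g) (items : ι → Item d) (A : Finset ι) :
    ∃ x ∈ Icc (0 : ι → ℝ) 1, fracValue g items A x = fracOpt g items A := by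
  obtain ⟨x, hx, hmax⟩ := (isCompact_Icc (a := (0 : ι → ℝ)) (b := 1)).exists_isMaxOn
    ⟨0, le_rfl, zero_le_one⟩ (f := fracValue g items A) (by
      refine ContinuousOn.sub (Continuous.continuousOn (by fun_prop)) (hg.continuousOn.comp
        (Continuous.continuousOn (by fun_prop)) fun x hx => fracSize_nonneg items A hx.1))
  exact ⟨x, hx, le_antisymm (hg.le_fracOpt items A hx) (fracOpt_le fun y hy => hmax hy)⟩

/-- Incremental costs with respect to some order of `A`: they sum up to the total cost and dominate
the cost of every subset. -/
lemma exists_cost_shares [DecidableEq ι] (hg : IsRegularSupermodularCost g) {y : ι → Fin d → ℝ}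
    (hy : ∀ i, 0 ≤ y i) (A : Finset ι) :
    ∃ c : ι → ℝ, ∑ i ∈ A, c i = g (∑ i ∈ A, y i) ∧
      (∀ B ⊆ A, g (∑ i ∈ B, y i) ≤ ∑ i ∈ B, c i) ∧
      ∀ j ∈ A, g (y j) ≤ c j ∧ c j ≤ g (∑ i ∈ A, y i) - g (∑ i ∈ A.erase j, y i) := by
  have hsum : ∀ B : Finset ι, 0 ≤ ∑ i ∈ B, y i := fun B => Finset.sum_nonneg fun i _ => hy i
  have hsub : ∀ {B C : Finset ι}, B ⊆ C → ∑ i ∈ B, y i ≤ ∑ i ∈ C, y i := fun h =>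
    Finset.sum_le_sum_of_subset_of_nonneg h fun i _ _ => hy i
  induction A using Finset.induction_on with
  | empty =>
    refine ⟨0, by simp [hg.map_zero], fun B hB => ?_, by simp⟩
    simp [Finset.subset_empty.1 hB, hg.map_zero]
  | insert a A ha ih =>
    obtain ⟨c, h1, h2, h3⟩ := ih
    -- The new item pays its marginal cost on top of all earlier ones. By increasing differences
    -- this is at least its marginal cost on top of any subset of them.
    set c' : ι → ℝ := Function.update c a (g (∑ i ∈ A, y i + y a) - g (∑ i ∈ A, y i)) with hc'
    have hcA : ∀ B ⊆ A, ∑ i ∈ B, c' i = ∑ i ∈ B, c i := fun B hB =>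
      Finset.sum_congr rfl fun i hi =>
        Function.update_of_ne (fun h : i = a => ha (hB (h ▸ hi))) _ _
    have hca : c' a = g (∑ i ∈ A, y i + y a) - g (∑ i ∈ A, y i) := Function.update_self ..
    refine ⟨c', ?_, ?_, ?_⟩
    · rw [Finset.sum_insert ha, hcA A subset_rfl, h1, hca, Finset.sum_insert ha, add_comm (y a)]
      ring
    · intro B hB
      by_cases haB : a ∈ B
      · have hBA : B.erase a ⊆ A := by
          intro i hi
          rw [Finset.mem_erase] at hi
          exact Finset.mem_of_mem_insert_of_ne (hB hi.2) hi.1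
        rw [← Finset.add_sum_erase _ _ haB, ← Finset.add_sum_erase _ _ haB, hcA _ hBA, hca]
        have h4 := hg.increments (hsum (B.erase a)) (hsub hBA) (hy a)
        have h5 := h2 _ hBA
        rw [add_comm (y a)]
        linarith
      · have hBA : B ⊆ A := fun i hi =>
          Finset.mem_of_mem_insert_of_ne (hB hi) (fun h => haB (h ▸ hi))
        rw [hcA B hBA]
        exact h2 B hBA
    · intro j hj
      rcases Finset.mem_insert.1 hj with rfl | hjA
      · rw [hca, Finset.erase_insert ha, Finset.sum_insert ha, add_comm (y j)]
        refine ⟨?_, le_rfl⟩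
        have := hg.superadditive (hsum A) (hy j)
        linarith
      · have hne : j ≠ a := fun h => ha (h ▸ hjA)
        have hcj : c' j = c j := Function.update_of_ne hne _ _
        rw [hcj, Finset.erase_insert_of_ne hne.symm, Finset.sum_insert ha, Finset.sum_insert
          (fun h => ha (Finset.mem_of_mem_erase h))]
        refine ⟨(h3 j hjA).1, (h3 j hjA).2.trans ?_⟩
        have e : ∀ z : Fin d → ℝ, z + ∑ i ∈ A, y i = (z + ∑ i ∈ A.erase j, y i) + y j := by
          intro z
          rw [← Finset.sum_erase_add _ _ hjA, add_assoc]
        have h4 := hg.increments (hsum (A.erase j))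
          (le_add_of_nonneg_left (hy a) : _ ≤ y a + ∑ i ∈ A.erase j, y i) (hy j)
        rw [e, ← Finset.sum_erase_add _ _ hjA]
        exact h4

/-- The fractional optimum splits into bounded nonnegative shares of the items such that every
subset has at least the fractional optimum given by its shares. -/
lemma exists_shares (hg : IsRegularSupermodularCost g) (items : ι → Item d) (A : Finset ι) :
    ∃ w : ι → ℝ, ∑ i ∈ A, w i = fracOpt g items A ∧
      (∀ B ⊆ A, ∑ i ∈ B, w i ≤ fracOpt g items B) ∧
      ∀ j ∈ A, 0 ≤ w j ∧ w j ≤ fracOpt g items {j} := by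
  obtain ⟨x, hx, hmax⟩ := hg.exists_fracOpt_eq items A
  obtain ⟨c, h1, h2, h3⟩ := hg.exists_cost_shares (y := fun i => x i • (items i).size)
    (fun i => smul_nonneg (hx.1 i) (items i).size_nonneg) A
  refine ⟨fun i => x i * (items i).value - c i, ?_, ?_, ?_⟩
  · rw [Finset.sum_sub_distrib, h1, ← hmax, fracValue]
  · intro B hB
    rw [Finset.sum_sub_distrib]
    refine le_trans ?_ (hg.le_fracOpt items B hx)
    rw [fracValue]
    linarith [h2 B hB]
  · intro j hj
    constructor
    -- The share is nonnegative because dropping `j` from an optimal solution cannot help, and `j`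
    -- is charged at most its marginal cost with respect to all the others.
    · have h4 := hg.le_fracOpt items (A.erase j) hx
      have h5 := hg.fracOpt_mono items (Finset.erase_subset j A)
      rw [← hmax] at h5
      simp only [fracValue] at h4 h5
      rw [← Finset.sum_erase_add _ _ hj] at h5
      linarith [(h3 j hj).2]
    · refine le_trans ?_ (hg.le_fracOpt items {j} hx)
      simp only [fracValue, Finset.sum_singleton]
      linarith [(h3 j hj).1]

lemma single_le_fracOpt (hg : IsRegularSupermodularCost g) (items : ι → Item d) (j : ι) {θ : ℝ}
    (hθ : θ ∈ Icc (0 : ℝ) 1) :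
    θ * (items j).value - g (θ • (items j).size) ≤ fracOpt g items {j} := by
  have := hg.le_fracOpt items {j} (x := fun _ => θ) ⟨fun _ => hθ.1, fun _ => hθ.2⟩
  simpa [fracValue] using this

/-- A non-exceptional item has a best extent of `0` or `1`. Thus bounds on profits of whole items
also bound fractional ones. -/
lemma fracOpt_single_le (hg : IsRegularSupermodularCost g) (items : ι → Item d) {j : ι}
    (hj : ¬ IsExceptional g (items j)) :
    fracOpt g items {j} ≤ max 0 (profit g {items j}) := by
  simp only [IsExceptional, not_forall] at hj
  obtain ⟨θ, hθ, hmax, hne⟩ := hj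
  have hv : θ * (items j).value - g (θ • (items j).size) ≤ max 0 (profit g {items j}) := by
    rcases hθ.1.eq_or_lt with rfl | h0
    · simp [hg.map_zero]
    · rcases hθ.2.eq_or_lt with rfl | h1
      · simp [profit]
      · exact (hne ⟨h0, h1⟩).elim
  refine fracOpt_le fun x hx => ?_
  simp only [fracValue, Finset.sum_singleton]
  exact (hmax (show x j ∈ Icc (0 : ℝ) 1 from ⟨hx.1 j, hx.2 j⟩)).trans hv

lemma fracValue_one (items : ι → Item d) (A : Finset ι) :
    fracValue g items A 1 = profit g (A.val.map items) := by
  simp [fracValue, profit]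

lemma profit_le_fracOpt (hg : IsRegularSupermodularCost g) (items : ι → Item d) (A : Finset ι) :
    profit g (A.val.map items) ≤ fracOpt g items A := by
  rw [← fracValue_one]
  exact hg.le_fracOpt items A ⟨zero_le_one, le_rfl⟩

/-- If all items of `A` are picked by prices at which their total size is optimal, then taking all
of `A` is fractionally optimal. -/
lemma fracOpt_le_profit {items : ι → Item d} {A : Finset ι} {l : Fin d → ℝ}
    (hA : ∀ i ∈ A, l ⬝ᵥ (items i).size ≤ (items i).value)
    (hmax : IsBoxMax g l (∑ i ∈ A, (items i).size)) :
    fracOpt g items A ≤ profit g (A.val.map items) := by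
  refine fracOpt_le fun x hx => ?_
  rw [← fracValue_one]
  have h1 := hmax _ (fracSize_nonneg items A hx.1)
    (Finset.sum_le_sum fun i _ => smul_le_of_le_one_left (items i).size_nonneg (hx.2 i))
  have h2 : ∑ i ∈ A, x i * ((items i).value - l ⬝ᵥ (items i).size) ≤
      ∑ i ∈ A, ((items i).value - l ⬝ᵥ (items i).size) :=
    Finset.sum_le_sum fun i hi => mul_le_of_le_one_left (sub_nonneg.2 (hA i hi)) (hx.2 i)
  simp only [mul_sub, Finset.sum_sub_distrib] at h2
  simp only [fracValue, dotProduct_sum, dotProduct_smul, smul_eq_mul, Pi.one_apply, one_mul,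
    one_smul] at h1 ⊢
  linarith

/-- Prices at which all marginal duals are equal to `G` pick a set of large fractional optimum. -/
lemma min_le_fracOpt_pickedSet (hg : IsRegularSupermodularCost g) (items : ι → Item d)
    (A : Finset ι) {l : Fin d → ℝ} (hl : 0 ≤ l) {G : ℝ}
    (hG : ∀ i, marginalDual g i (l i) = G) :
    min (fracOpt g items A - d * G) G ≤ fracOpt g items (pickedSet items l A) := by
  set B := pickedSet items l A with hB
  set T := ∑ i ∈ B, (items i).size with hT
  have hT0 : 0 ≤ T := Finset.sum_nonneg fun i _ => (items i).size_nonneg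
  have hBv : ∀ i ∈ B, l ⬝ᵥ (items i).size ≤ (items i).value := fun i hi =>
    (Finset.mem_filter.1 hi).2
  -- If taking all of `B` is optimal at prices `l`, any solution is worth at most the surplus of `B`
  -- plus the dual bound `d * G`, and comparison with the empty solution bounds that surplus by the
  -- optimum of `B`. Otherwise, scaling all of `B` by a common factor reaches value nearly `G`.
  by_cases h : IsBoxMax g l T
  · refine (min_le_left _ _).trans ?_
    rw [sub_le_iff_le_add]
    have hfull : ∑ i ∈ B, ((items i).value - l ⬝ᵥ (items i).size) ≤ fracOpt g items B := by
      refine le_trans ?_ (hg.le_fracOpt items B (x := 1) ⟨zero_le_one, le_rfl⟩)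
      have := h 0 le_rfl hT0
      simp only [dotProduct_zero, hg.map_zero, hT, dotProduct_sum] at this
      simp only [fracValue, Pi.one_apply, one_mul, one_smul, Finset.sum_sub_distrib]
      linarith
    refine fracOpt_le fun x hx => ?_
    have h1 := hg.dotProduct_sub_le l (fracSize_nonneg items A hx.1)
    simp only [hG, Finset.sum_const, Finset.card_univ, Fintype.card_fin, nsmul_eq_mul] at h1
    have h2 : ∑ i ∈ A, x i * ((items i).value - l ⬝ᵥ (items i).size) ≤
        ∑ i ∈ B, ((items i).value - l ⬝ᵥ (items i).size) := by
      rw [hB, pickedSet, Finset.sum_filter]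
      refine Finset.sum_le_sum fun i _ => ?_
      split_ifs with hi
      · exact mul_le_of_le_one_left (sub_nonneg.2 hi) (hx.2 i)
      · exact mul_nonpos_of_nonneg_of_nonpos (hx.1 i) (sub_nonpos.2 (not_le.1 hi).le)
    simp only [mul_sub, Finset.sum_sub_distrib] at h2 hfull
    simp only [fracValue, dotProduct_sum, dotProduct_smul, smul_eq_mul] at h1 ⊢
    linarith
  · refine (min_le_right _ _).trans (le_of_forall_pos_sub_le fun δ hδ => ?_)
    have h0 : IsBoxMax g l 0 := fun z hz hz' => by rw [le_antisymm hz' hz]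
    obtain ⟨θ, hθ, h1⟩ := hg.exists_on_segment hl le_rfl hT0 h0 (by rwa [zero_add])
      (fun i => (hG i).ge) hδ
    refine h1.trans (le_trans ?_ (hg.le_fracOpt items B (x := fun _ => θ)
      ⟨fun _ => hθ.1, fun _ => hθ.2⟩))
    rw [zero_add, fracValue, ← Finset.smul_sum, dotProduct_smul, hT, dotProduct_sum, smul_eq_mul,
      Finset.mul_sum]
    exact sub_le_sub_right (Finset.sum_le_sum fun i hi =>
      mul_le_mul_of_nonneg_left (hBv i hi) hθ.1) _

lemma opt_le_fracOpt (hg : IsRegularSupermodularCost g) {n : ℕ} (items : Fin n → Item d) :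
    opt g items ≤ fracOpt g items Finset.univ :=
  Finset.sup'_le _ _ fun A _ =>
    (hg.profit_le_fracOpt items A).trans (hg.fracOpt_mono items (Finset.subset_univ A))

end IsRegularSupermodularCost

/-! ### Lists of items given by lists of indices -/

lemma sum_get_map [DecidableEq ι] {M : Type*} [AddCommMonoid M] (items : ι → Item d) {ℓ : List ι} (hℓ : ℓ.Nodup)
    (f : ι → Item d → M) :
    ∑ j : Fin (ℓ.map items).length,
      f (ℓ.get (j.cast (List.length_map _))) ((ℓ.map items).get j) =
      ∑ i ∈ ℓ.toFinset, f i (items i) := by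
  rw [List.sum_toFinset _ hℓ, ← Fin.sum_univ_fun_getElem ℓ (fun i => f i (items i))]
  refine Fintype.sum_equiv (finCongr (List.length_map _)) _ _ fun j => ?_
  simp

lemma fopt_map [DecidableEq ι] (items : ι → Item d) {ℓ : List ι} (hℓ : ℓ.Nodup) :
    fopt g (ℓ.map items) = fracOpt g items ℓ.toFinset := by
  have key : ∀ (x : Fin (ℓ.map items).length → ℝ) (y : ι → ℝ),
      (∀ j, x j = y (ℓ.get (j.cast (List.length_map _)))) →
      ∑ i, x i * ((ℓ.map items).get i).value - g (∑ i, x i • ((ℓ.map items).get i).size) =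
        fracValue g items ℓ.toFinset y := by
    intro x y hxy
    simp only [hxy]
    rw [fracValue, ← sum_get_map items hℓ fun i e => y i * e.value,
      ← sum_get_map items hℓ fun i e => y i • e.size]
  unfold fopt fracOpt
  congr 1
  ext c
  constructor
  · rintro ⟨x, hx, rfl⟩
    -- A solution indexed by positions is transported through the first position of each index,
    -- which is its only one as `ℓ` has no duplicates.
    refine ⟨fun i => if h : i ∈ ℓ then
      x ⟨ℓ.idxOf i, by simpa using List.idxOf_lt_length_of_mem h⟩ else 0, ⟨?_, ?_⟩, ?_⟩
    · intro i
      by_cases h : i ∈ ℓ <;> simp only [h, dite_true, dite_false, Pi.zero_apply, le_refl]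
      exact hx.1 _
    · intro i
      by_cases h : i ∈ ℓ <;> simp only [h, dite_true, dite_false, Pi.one_apply, zero_le_one]
      exact hx.2 _
    · refine (key _ _ fun j => ?_).symm
      have hj : (j : ℕ) < ℓ.length := by simpa using j.2
      simp [hℓ.idxOf_getElem]
  · rintro ⟨y, hy, rfl⟩
    exact ⟨fun j => y (ℓ.get (j.cast (List.length_map _))), ⟨fun j => hy.1 _, fun j => hy.2 _⟩,
      key _ _ fun j => rfl⟩

lemma picked_map (items : ι → Item d) (l : Fin d → ℝ) (ℓ : List ι) :
    picked l (ℓ.map items) =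
      (ℓ.filter fun i => l ⬝ᵥ (items i).size ≤ (items i).value).map items := by
  rw [picked, List.filter_map]
  rfl

lemma fopt_picked_map [DecidableEq ι] (items : ι → Item d) (l : Fin d → ℝ) {ℓ : List ι} (hℓ : ℓ.Nodup) :
    fopt g (picked l (ℓ.map items)) = fracOpt g items (pickedSet items l ℓ.toFinset) := by
  rw [picked_map, fopt_map items (hℓ.filter _), pickedSet, List.toFinset_filter]
  simp

/-! ### Greedy solutions -/

lemma greedySolution_concat (P : Item d → Prop) (R : List (Item d)) (e : Item d) :
    greedySolution g P (R ++ [e]) =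
      if GreedyAccepts g P (greedySolution g P R) e then e ::ₘ greedySolution g P R
      else greedySolution g P R := by
  rw [greedySolution, List.foldl_append]
  rfl

lemma profit_greedySolution_concat (P : Item d → Prop) (R : List (Item d)) (e : Item d) :
    profit g (greedySolution g P R) ≤ profit g (greedySolution g P (R ++ [e])) := by
  rw [greedySolution_concat]
  split_ifs with h
  · exact h.2
  · exact le_rfl

lemma profit_greedySolution_nonneg (h0 : g 0 = 0) (P : Item d → Prop) (R : List (Item d)) :
    0 ≤ profit g (greedySolution g P R) := by
  induction R using List.reverseRecOn with
  | nil => simp [greedySolution, profit, h0]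
  | append_singleton R e ih => exact ih.trans (profit_greedySolution_concat P R e)

/-- If every item that passes the filter has profit at least `M`, then so has the greedy solution,
provided that some item passes. -/
lemma le_profit_greedySolution_of_forall (h0 : g 0 = 0) {P : Item d → Prop} {R : List (Item d)}
    {M : ℝ} (hM : 0 ≤ M) (hR : ∀ e ∈ R, P e → M ≤ profit g {e}) (hex : ∃ e ∈ R, P e) :
    M ≤ profit g (greedySolution g P R) := by
  suffices H : ((∀ e ∈ R, ¬ P e) ∧ greedySolution g P R = 0) ∨
      M ≤ profit g (greedySolution g P R) by
    rcases H with H | H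
    · obtain ⟨e, he, hP⟩ := hex
      exact (H.1 e he hP).elim
    · exact H
  clear hex
  induction R using List.reverseRecOn with
  | nil => simp [greedySolution]
  | append_singleton R e ih =>
    rcases ih fun f hf => hR f (by simp [hf]) with ⟨h1, h2⟩ | h
    · by_cases hP : P e
      · right
        have he := hR e (by simp) hP
        have : GreedyAccepts g P 0 e := ⟨hP, by simpa [profit, h0] using hM.trans he⟩
        rw [greedySolution_concat, h2, if_pos this]
        exact he
      · left
        refine ⟨fun f hf => ?_, ?_⟩
        · rcases List.mem_append.1 hf with hf | hf
          · exact h1 f hf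
          · rwa [List.mem_singleton.1 hf]
        · rw [greedySolution_concat, if_neg fun h => hP h.1, h2]
    · exact Or.inr (h.trans (profit_greedySolution_concat P R e))

/-- If the items that pass the filter are picked by prices `l`, then either the greedy solution
contains all of them, and its total size is optimal for `l`, or it has profit at least `G - ε`. -/
lemma IsRegularSupermodularCost.greedySolution_dichotomy (hg : IsRegularSupermodularCost g)
    {P : Item d → Prop} {R : List (Item d)} {l : Fin d → ℝ} (hl : 0 ≤ l) {G ε : ℝ}
    (hG : ∀ i, G ≤ marginalDual g i (l i)) (hP : ∀ e ∈ R, P e → l ⬝ᵥ e.size ≤ e.value)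
    (hε : ∀ e ∈ R, P e → ∀ θ ∈ Icc (0 : ℝ) 1, θ * e.value - g (θ • e.size) ≤ ε) :
    (greedySolution g P R = (R.filter fun e => P e : List (Item d)) ∧
      IsBoxMax g l ((R.filter fun e => P e).map Item.size).sum) ∨
    G - ε ≤ profit g (greedySolution g P R) := by
  induction R using List.reverseRecOn with
  | nil =>
    left
    refine ⟨by simp [greedySolution], fun z hz hz' => ?_⟩
    simp only [List.filter_nil, List.map_nil, List.sum_nil] at hz' ⊢
    rw [le_antisymm hz' hz]
  | append_singleton R e ih =>
    rcases ih (fun f hf => hP f (by simp [hf])) (fun f hf => hε f (by simp [hf])) with ⟨h1, h2⟩ | h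
    swap
    · exact Or.inr (h.trans (profit_greedySolution_concat P R e))
    by_cases hPe : P e
    swap
    · left
      rw [greedySolution_concat, if_neg fun h => hPe h.1, List.filter_append]
      simpa [hPe] using And.intro h1 h2
    set S := ((R.filter fun e => P e).map Item.size).sum with hS
    have hS0 : 0 ≤ S := List.sum_nonneg fun s hs => by
      obtain ⟨f, -, rfl⟩ := List.mem_map.1 hs
      exact f.size_nonneg
    have hprofit : profit g (greedySolution g P R) =
        ((R.filter fun e => P e).map Item.value).sum - g S := by
      rw [h1, profit, Multiset.map_coe, Multiset.sum_coe, Multiset.map_coe, Multiset.sum_coe]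
    have hprofit' : profit g (e ::ₘ greedySolution g P R) =
        e.value + ((R.filter fun e => P e).map Item.value).sum - g (e.size + S) := by
      rw [h1, profit, Multiset.map_cons, Multiset.sum_cons, Multiset.map_cons, Multiset.sum_cons,
        Multiset.map_coe, Multiset.sum_coe, Multiset.map_coe, Multiset.sum_coe]
    have hle := hP e (by simp) hPe
    -- If the box stays optimal, comparing its top with `S` shows that the price of `e` covers its
    -- marginal cost, so `e` is accepted.
    by_cases hbox : IsBoxMax g l (S + e.size)
    · left
      have hacc : GreedyAccepts g P (greedySolution g P R) e := by
        refine ⟨hPe, ?_⟩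
        have h3 := hbox S hS0 (le_add_of_nonneg_right e.size_nonneg)
        rw [dotProduct_add] at h3
        rw [hprofit, hprofit', add_comm e.size]
        linarith
      rw [greedySolution_concat, if_pos hacc, List.filter_append, h1]
      refine ⟨?_, ?_⟩
      · rw [Multiset.cons_coe, Multiset.coe_eq_coe]
        simpa [hPe] using (List.perm_append_singleton e _).symm
      · simpa [hPe] using hbox
    · right
      refine le_trans (le_of_forall_pos_sub_le fun δ hδ => ?_)
        (profit_greedySolution_concat P R e)
      -- The current solution together with a fraction `θ` of `e` would be worth almost `G`. By
      -- superadditivity that fraction contributes at most `ε`, so the solution held before `e`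
      -- arrived is already good enough.
      obtain ⟨θ, hθ, h3⟩ := hg.exists_on_segment hl hS0 e.size_nonneg h2 hbox hG hδ
      have h4 := hg.superadditive hS0 (smul_nonneg hθ.1 e.size_nonneg)
      have h5 := hε e (by simp) hPe θ hθ
      have h6 : l ⬝ᵥ S ≤ ((R.filter fun e => P e).map Item.value).sum := by
        have : ∀ R' : List (Item d), (∀ f ∈ R', l ⬝ᵥ f.size ≤ f.value) →
            l ⬝ᵥ (R'.map Item.size).sum ≤ (R'.map Item.value).sum := by
          intro R' hR'
          induction R' with
          | nil => simp
          | cons f R' ih =>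
            rw [List.map_cons, List.sum_cons, List.map_cons, List.sum_cons, dotProduct_add]
            exact add_le_add (hR' f (by simp)) (ih fun f hf => hR' f (by simp [hf]))
        refine this _ fun f hf => ?_
        rw [List.mem_filter] at hf
        exact hP f (by simp [hf.1]) (by simpa using hf.2)
      have h7 := mul_le_mul_of_nonneg_left hle hθ.1
      rw [dotProduct_add, dotProduct_smul, smul_eq_mul] at h3
      rw [hprofit]
      linarith

lemma IsRegularSupermodularCost.min_le_profit_greedySolution [DecidableEq ι] (hg : IsRegularSupermodularCost g)
    (items : ι → Item d) {P : Item d → Prop} {ℓ : List ι} (hℓ : ℓ.Nodup) {l : Fin d → ℝ}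
    (hl : 0 ≤ l) {G ε : ℝ} (hG : ∀ i, G ≤ marginalDual g i (l i))
    (hP : ∀ j, P (items j) → l ⬝ᵥ (items j).size ≤ (items j).value)
    (hε : ∀ j, P (items j) → fracOpt g items {j} ≤ ε) :
    min (fracOpt g items (ℓ.toFinset.filter fun j => P (items j))) (G - ε) ≤
      profit g (greedySolution g P (ℓ.map items)) := by
  rcases hg.greedySolution_dichotomy (P := P) (R := ℓ.map items) hl hG
    (fun e he => by obtain ⟨j, -, rfl⟩ := List.mem_map.1 he; exact hP j)
    (fun e he h θ hθ => by
      obtain ⟨j, -, rfl⟩ := List.mem_map.1 he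
      exact (hg.single_le_fracOpt items j hθ).trans (hε j h)) with ⟨h1, h2⟩ | h
  · refine (min_le_left _ _).trans ?_
    have hfilter : ((ℓ.map items).filter fun e => P e) =
        (ℓ.filter fun j => P (items j)).map items := by
      rw [List.filter_map]; rfl
    have hset : (ℓ.toFinset.filter fun j => P (items j)) =
        (ℓ.filter fun j => P (items j)).toFinset := by
      rw [List.toFinset_filter]; simp
    have hval : (ℓ.toFinset.filter fun j => P (items j)).val =
        ((ℓ.filter fun j => P (items j) : List ι) : Multiset ι) := by
      rw [hset, List.toFinset_val, (hℓ.filter _).dedup]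
    have hmul : greedySolution g P (ℓ.map items) =
        (ℓ.toFinset.filter fun j => P (items j)).val.map items := by
      rw [h1, hfilter, hval, Multiset.map_coe]
    rw [hmul]
    refine IsRegularSupermodularCost.fracOpt_le_profit (l := l)
      (fun i hi => hP i (Finset.mem_filter.1 hi).2) ?_
    rw [hfilter, List.map_map] at h2
    rwa [hset, List.sum_toFinset _ (hℓ.filter _)]
  · exact (min_le_right _ _).trans h

end

/-! ### Random halves, random orders, and the expected profit of sample-then-greedy rules. -/

noncomputable section

variable {d : ℕ} {g : (Fin d → ℝ) → ℝ}

/-! ### Concentration for a uniformly random subset -/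

/-- Toggling the membership of `i` is an involution on subsets that reverses the sign of each term.
-/
lemma sum_sign_mul_sign {ι : Type*} [Fintype ι] [DecidableEq ι] {i j : ι} (hij : i ≠ j) :
    ∑ L : Finset ι, (if i ∈ L then (1 : ℝ) else -1) * (if j ∈ L then 1 else -1) = 0 := by
  have hinv : Function.Involutive fun L : Finset ι => symmDiff L {i} := fun L => by
    simp
  have := Equiv.sum_comp (hinv.toPerm (fun L : Finset ι => symmDiff L {i}))
    fun L : Finset ι => (if i ∈ L then (1 : ℝ) else -1) * (if j ∈ L then 1 else -1)
  have h2 : ∀ L : Finset ι, (if i ∈ hinv.toPerm (fun L : Finset ι => symmDiff L {i}) L then (1 : ℝ) else -1) *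
      (if j ∈ hinv.toPerm (fun L : Finset ι => symmDiff L {i}) L then 1 else -1) =
      -((if i ∈ L then (1 : ℝ) else -1) * (if j ∈ L then 1 else -1)) := by
    intro L
    have e1 : i ∈ symmDiff L {i} ↔ i ∉ L := by simp [Finset.mem_symmDiff]
    have e2 : j ∈ symmDiff L {i} ↔ j ∈ L := by simp [Finset.mem_symmDiff, hij.symm]
    simp only [Function.Involutive.coe_toPerm, e1, e2]
    by_cases h : i ∈ L <;> by_cases h' : j ∈ L <;> simp [h, h']
  simp only [h2, Finset.sum_neg_distrib] at this
  linarith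

lemma sum_sign_sq {ι : Type*} [Fintype ι] [DecidableEq ι] (w : ι → ℝ) :
    ∑ L : Finset ι, (∑ i, (if i ∈ L then (1 : ℝ) else -1) * w i) ^ 2 =
      2 ^ Fintype.card ι * ∑ i, w i ^ 2 := by
  have : ∀ L : Finset ι, (∑ i, (if i ∈ L then (1 : ℝ) else -1) * w i) ^ 2 =
      ∑ i, ∑ j, ((if i ∈ L then (1 : ℝ) else -1) * (if j ∈ L then 1 else -1)) * (w i * w j) := by
    intro L
    rw [sq, Finset.sum_mul_sum]
    refine Finset.sum_congr rfl fun i _ => Finset.sum_congr rfl fun j _ => by ring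
  simp only [this]
  rw [Finset.sum_comm, Finset.mul_sum]
  refine Finset.sum_congr rfl fun i _ => ?_
  rw [Finset.sum_comm, Finset.sum_eq_single i]
  · rw [← Finset.sum_mul]
    have : ∀ L : Finset ι, (if i ∈ L then (1 : ℝ) else -1) * (if i ∈ L then 1 else -1) = 1 := by
      intro L; split_ifs <;> norm_num
    simp only [this, Finset.sum_const, Finset.card_univ, Fintype.card_finset, nsmul_eq_mul,
      mul_one, Nat.cast_pow, Nat.cast_ofNat]
    ring
  · intro j _ hj
    rw [← Finset.sum_mul, sum_sign_mul_sign hj.symm, zero_mul]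
  · simp

/-- Chebyshev's inequality: it is rare that a random half of `A` has less than a quarter of the
weight of `A`, if all weights are small. -/
lemma card_light_subsets_le {ι : Type*} [Fintype ι] [DecidableEq ι] {A : Finset ι} {w : ι → ℝ} {m : ℝ} (hm : 0 ≤ m)
    (hw : ∀ i ∈ A, 0 ≤ w i ∧ w i ≤ m) :
    ((Finset.univ.filter fun L : Finset ι => ∑ i ∈ A ∩ L, w i < (∑ i ∈ A, w i) / 4).card : ℝ) *
      (∑ i ∈ A, w i) ≤ 4 * m * 2 ^ Fintype.card ι := by
  set W := ∑ i ∈ A, w i with hW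
  set bad := Finset.univ.filter fun L : Finset ι => ∑ i ∈ A ∩ L, w i < W / 4 with hbad
  have hW0 : 0 ≤ W := Finset.sum_nonneg fun i hi => (hw i hi).1
  rcases hW0.eq_or_lt with h0 | hpos
  · have hbad0 : bad = ∅ := by
      refine Finset.filter_eq_empty_iff.2 fun L _ => ?_
      rw [← h0, not_lt, zero_div]
      exact Finset.sum_nonneg fun i hi => (hw i (Finset.mem_inter.1 hi).1).1
    rw [hbad0]
    simp only [Finset.card_empty, Nat.cast_zero, zero_mul]
    positivity
  set v : ι → ℝ := fun i => if i ∈ A then w i else 0 with hv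
  have hsign : ∀ L : Finset ι, ∑ i, (if i ∈ L then (1 : ℝ) else -1) * v i =
      2 * ∑ i ∈ A ∩ L, w i - W := by
    intro L
    have e1 : ∑ i ∈ A ∩ L, w i = ∑ i, if i ∈ L then v i else 0 := by
      rw [Finset.inter_comm, Finset.sum_ite_mem, Finset.univ_inter]
      simp only [hv, Finset.sum_ite_mem]
    have e2 : W = ∑ i, v i := by simp [hv, hW]
    rw [e1, e2, Finset.mul_sum, ← Finset.sum_sub_distrib]
    refine Finset.sum_congr rfl fun i _ => ?_
    split_ifs <;> ring
  -- On a bad set the signed sum `2 w(A ∩ L) - W` is below `-W / 2`, so its square is at least `W ^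
  -- 2 / 4`. The second moment is known exactly.
  have h1 : (bad.card : ℝ) * (W ^ 2 / 4) ≤ 2 ^ Fintype.card ι * ∑ i, v i ^ 2 := by
    rw [← sum_sign_sq, ← nsmul_eq_mul, ← Finset.sum_const]
    refine (Finset.sum_le_sum fun L hL => ?_).trans
      (Finset.sum_le_sum_of_subset_of_nonneg (Finset.subset_univ bad) fun L _ _ => sq_nonneg _)
    have := (Finset.mem_filter.1 hL).2
    rw [hsign]
    nlinarith
  have h2 : ∑ i, v i ^ 2 ≤ m * W := by
    have : ∑ i, v i ^ 2 = ∑ i ∈ A, w i ^ 2 := by simp [hv, ite_pow]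
    rw [this, hW, Finset.mul_sum]
    refine Finset.sum_le_sum fun i hi => ?_
    rw [sq]
    exact mul_le_mul_of_nonneg_right (hw i hi).2 (hw i hi).1
  have h3 : (bad.card : ℝ) * W * W ≤ 4 * m * 2 ^ Fintype.card ι * W := by
    have := mul_le_mul_of_nonneg_left h2 (by positivity : (0 : ℝ) ≤ 2 ^ Fintype.card ι)
    nlinarith
  exact le_of_mul_le_mul_right h3 hpos

/-! ### Uniformly random orders and binomial prefixes -/

/-- The first `k` positions. -/
def initialSet (n k : ℕ) : Finset (Fin n) := Finset.univ.filter fun i => (i : ℕ) < k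

lemma card_initialSet {n k : ℕ} (hk : k ≤ n) : (initialSet n k).card = k := by
  rw [initialSet, Fin.card_filter_val_lt, min_eq_right hk]

lemma exists_perm_map_eq {ι : Type*} [Fintype ι] {A B : Finset ι} (h : A.card = B.card) :
    ∃ τ : Equiv.Perm ι, A.map τ.toEmbedding = B := by
  refine ⟨(Finset.equivOfCardEq h).extendSubtype, ?_⟩
  refine Finset.eq_of_subset_of_card_le (fun x hx => ?_) (by rw [Finset.card_map, h])
  obtain ⟨y, hy, rfl⟩ := Finset.mem_map.1 hx
  exact (Finset.equivOfCardEq h).extendSubtype_mem y hy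

/-- Double counting of `f (σ A)` over all permutations `σ` and all `k`-sets `A`: the sum over `σ`
does not depend on `A`, and the sum over `A` does not depend on `σ`. -/
lemma choose_mul_sum_perm {n k : ℕ} (hk : k ≤ n) (f : Finset (Fin n) → ℝ) :
    (n.choose k : ℝ) * ∑ σ : Equiv.Perm (Fin n), f ((initialSet n k).map σ.toEmbedding) =
      n.factorial * ∑ A ∈ Finset.powersetCard k Finset.univ, f A := by
  have h1 : ∀ A ∈ Finset.powersetCard k (Finset.univ : Finset (Fin n)),
      ∑ σ : Equiv.Perm (Fin n), f (A.map σ.toEmbedding) =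
        ∑ σ : Equiv.Perm (Fin n), f ((initialSet n k).map σ.toEmbedding) := by
    intro A hA
    obtain ⟨τ, hτ⟩ := exists_perm_map_eq (A := initialSet n k) (B := A)
      (by rw [card_initialSet hk, (Finset.mem_powersetCard.1 hA).2])
    rw [← Equiv.sum_comp (Equiv.mulRight τ)
      fun σ : Equiv.Perm (Fin n) => f ((initialSet n k).map σ.toEmbedding)]
    refine Finset.sum_congr rfl fun σ _ => ?_
    rw [← hτ, Finset.map_map]
    rfl
  have h2 : ∀ σ : Equiv.Perm (Fin n),
      ∑ A ∈ Finset.powersetCard k Finset.univ, f (A.map σ.toEmbedding) =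
        ∑ A ∈ Finset.powersetCard k Finset.univ, f A := by
    intro σ
    have := Finset.powersetCard_map σ.toEmbedding k Finset.univ
    rw [Finset.map_univ_equiv] at this
    conv_rhs => rw [this, Finset.sum_map]
    rfl
  have h3 := Finset.sum_comm (s := Finset.powersetCard k (Finset.univ : Finset (Fin n)))
    (t := (Finset.univ : Finset (Equiv.Perm (Fin n)))) (f := fun A σ => f (A.map σ.toEmbedding))
  rw [Finset.sum_congr rfl h1, Finset.sum_congr rfl fun σ _ => h2 σ, Finset.sum_const,
    Finset.sum_const, Finset.card_powersetCard, Finset.card_univ, Finset.card_univ,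
    Fintype.card_perm, Fintype.card_fin] at h3
  simpa using h3

/-- A binomially long prefix of a uniformly random order is a uniformly random subset. -/
lemma sum_perm_sum_choose (n : ℕ) (f : Finset (Fin n) → ℝ) :
    ∑ σ : Equiv.Perm (Fin n), ∑ k ∈ Finset.range (n + 1),
      (n.choose k : ℝ) * f ((initialSet n k).map σ.toEmbedding) =
      n.factorial * ∑ A, f A := by
  rw [Finset.sum_comm]
  have h1 : ∀ k ∈ Finset.range (n + 1), ∑ σ : Equiv.Perm (Fin n),
      (n.choose k : ℝ) * f ((initialSet n k).map σ.toEmbedding) =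
      n.factorial * ∑ A ∈ Finset.powersetCard k Finset.univ, f A := by
    intro k hk
    rw [← Finset.mul_sum, choose_mul_sum_perm (Nat.lt_succ_iff.1 (Finset.mem_range.1 hk))]
  rw [Finset.sum_congr rfl h1, ← Finset.mul_sum]
  congr 1
  have := Finset.sum_powerset (Finset.univ : Finset (Fin n)) f
  rw [Finset.card_univ, Fintype.card_fin, Finset.powerset_univ] at this
  exact this.symm

/-! ### Sampling and then accepting greedily -/

/-- The decision rule that rejects `k` items, and then accepts greedily those items that pass a
filter learned from the first `k` items. -/
def SampleGreedyAccepts (g : (Fin d → ℝ) → ℝ) (P : List (Item d) → Item d → Prop) (k : ℕ)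
    (past : List (Item d)) (e : Item d) : Prop :=
  k ≤ past.length ∧
    GreedyAccepts g (P (past.take k)) (greedySolution g (P (past.take k)) (past.drop k)) e

/-- The solution obtained by `SampleGreedyAccepts` from the arrival order `σ`. -/
def sampleGreedy {n : ℕ} (g : (Fin d → ℝ) → ℝ) (items : Fin n → Item d)
    (P : List (Item d) → Item d → Prop) (σ : Equiv.Perm (Fin n)) (k : ℕ) : Multiset (Item d) :=
  greedySolution g (P (((List.ofFn σ).take k).map items)) (((List.ofFn σ).drop k).map items)

/-- The decision rule recomputes its current solution from the past items. Induction on the length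
of the prefix shows that the recomputed solution is the set accepted so far. -/
lemma accepted_eq_greedySolution {n : ℕ} (P : List (Item d) → Item d → Prop) (k : ℕ)
    (arrival : Fin n → Item d) :
    (Finset.univ.filter fun t : Fin n =>
      SampleGreedyAccepts g P k ((List.ofFn arrival).take t) (arrival t)).val.map arrival =
      greedySolution g (P ((List.ofFn arrival).take k)) ((List.ofFn arrival).drop k) := by
  set L := List.ofFn arrival with hL
  set acc : Fin n → Prop := fun t => SampleGreedyAccepts g P k (L.take t) (arrival t) with hacc
  suffices H : ∀ m ≤ n, (Finset.univ.filter fun t : Fin n => (t : ℕ) < m ∧ acc t).val.map arrival =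
      greedySolution g (P (L.take k)) ((L.take m).drop k) by
    have := H n le_rfl
    simp only [Fin.is_lt, true_and] at this
    rwa [List.take_of_length_le (i := n) (l := L) (by simp [hL])] at this
  intro m
  induction m with
  | zero => intro; simp [greedySolution]
  | succ m ih =>
    intro hm
    have ih := ih (by omega)
    set t : Fin n := ⟨m, hm⟩ with ht
    have htake : L.take (m + 1) = L.take m ++ [arrival t] := by
      rw [List.take_succ_eq_append_getElem (by simpa [hL] using hm)]
      simp [hL, ht]
    have hlen : (L.take m).length = m := by simp [hL]; omega
    have hfilter : (Finset.univ.filter fun s : Fin n => (s : ℕ) < m + 1 ∧ acc s) =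
        if acc t then insert t (Finset.univ.filter fun s : Fin n => (s : ℕ) < m ∧ acc s)
        else (Finset.univ.filter fun s : Fin n => (s : ℕ) < m ∧ acc s) := by
      ext s
      have hs : (s : ℕ) < m + 1 ↔ s = t ∨ (s : ℕ) < m := by
        rw [Fin.ext_iff, Nat.lt_succ_iff_lt_or_eq, or_comm]
      split_ifs with h
      · simp only [Finset.mem_filter, Finset.mem_univ, true_and, Finset.mem_insert, hs]
        constructor
        · rintro ⟨rfl | h1, h2⟩
          · exact Or.inl rfl
          · exact Or.inr ⟨h1, h2⟩
        · rintro (rfl | h1)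
          · exact ⟨Or.inl rfl, h⟩
          · exact ⟨Or.inr h1.1, h1.2⟩
      · simp only [Finset.mem_filter, Finset.mem_univ, true_and, hs]
        constructor
        · rintro ⟨rfl | h1, h2⟩
          · exact (h h2).elim
          · exact ⟨h1, h2⟩
        · exact fun h1 => ⟨Or.inr h1.1, h1.2⟩
    have htmem : t ∉ Finset.univ.filter fun s : Fin n => (s : ℕ) < m ∧ acc s := by simp [ht]
    rw [hfilter, htake]
    rcases le_or_gt k m with hkm | hkm
    · have htk : (L.take m).take k = L.take k := by rw [List.take_take, min_eq_left hkm]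
      have hacct : acc t ↔ GreedyAccepts g (P (L.take k))
          (greedySolution g (P (L.take k)) ((L.take m).drop k)) (arrival t) := by
        simp only [hacc, SampleGreedyAccepts, ht, hlen, hkm, true_and, htk]
      rw [List.drop_append_of_le_length (by omega), greedySolution_concat, ← hacct]
      split_ifs with h
      · rw [Finset.insert_val_of_notMem htmem, Multiset.map_cons, ih]
      · exact ih
    · have hacct : ¬ acc t := by
        simp only [hacc, SampleGreedyAccepts, ht, hlen]
        exact fun h => absurd h.1 (by omega)
      rw [if_neg hacct, ih, List.drop_of_length_le (by omega),
        List.drop_of_length_le (by simp; omega)]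

lemma profit_accepted_eq {n : ℕ} (items : Fin n → Item d) (P : List (Item d) → Item d → Prop)
    (k : ℕ) (σ : Equiv.Perm (Fin n)) :
    (Finset.univ.filter fun t : Fin n => SampleGreedyAccepts g P k
      ((List.ofFn (items ∘ σ)).take t) ((items ∘ σ) t)).val.map (items ∘ σ) =
      sampleGreedy g items P σ k := by
  rw [accepted_eq_greedySolution, ← List.map_ofFn, sampleGreedy, List.map_take, List.map_drop]

/-- If the greedy solution has profit at least `c` whenever the sample is good, then its expected
profit is at least `c` times the fraction of the good samples. -/
lemma mul_card_good_le {n : ℕ} (h0 : g 0 = 0) (items : Fin n → Item d)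
    (P : List (Item d) → Item d → Prop) (good : Finset (Fin n) → Prop) {c : ℝ}
    (hgood : ∀ ℓ₁ ℓ₂ : List (Fin n), (ℓ₁ ++ ℓ₂).Nodup → (∀ i, i ∈ ℓ₁ ++ ℓ₂) → good ℓ₁.toFinset →
      c ≤ profit g (greedySolution g (P (ℓ₁.map items)) (ℓ₂.map items))) :
    n.factorial * (c * (Finset.univ.filter good).card) ≤
      ∑ σ : Equiv.Perm (Fin n), ∑ k ∈ Finset.range (n + 1),
        (n.choose k : ℝ) * profit g (sampleGreedy g items P σ k) := by
  have h1 := sum_perm_sum_choose n fun A => if good A then c else 0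
  -- The profit is bounded below by the indicator of good samples times `c`, using that greedy
  -- profits are never negative.
  rw [← Finset.sum_filter, Finset.sum_const, nsmul_eq_mul, mul_comm _ c] at h1
  rw [← h1]
  refine Finset.sum_le_sum fun σ _ => Finset.sum_le_sum fun k _ =>
    mul_le_mul_of_nonneg_left ?_ (Nat.cast_nonneg _)
  have hset : (initialSet n k).map σ.toEmbedding = ((List.ofFn σ).take k).toFinset := by
    ext i
    simp only [initialSet, Finset.mem_map, Finset.mem_filter, Finset.mem_univ, true_and,
      Equiv.coe_toEmbedding, List.mem_toFinset, List.mem_take_iff_getElem, List.length_ofFn,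
      List.getElem_ofFn, lt_min_iff]
    constructor
    · rintro ⟨a, ha, rfl⟩
      exact ⟨a, ⟨ha, a.2⟩, rfl⟩
    · rintro ⟨a, ha, rfl⟩
      exact ⟨⟨a, ha.2⟩, ha.1, rfl⟩
  rw [hset]
  split_ifs with h
  · refine hgood _ _ ?_ ?_ h
    · rw [List.take_append_drop]
      exact List.nodup_ofFn.2 σ.injective
    · intro i
      rw [List.take_append_drop, List.mem_ofFn]
      exact σ.surjective i
  · exact profit_greedySolution_nonneg h0 _ _

lemma expectedProfit_classifierAlgorithm {n : ℕ} (C : Set (Fin d → ℝ)) (items : Fin n → Item d) :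
    (classifierAlgorithm g C n).expectedProfit g items =
      (∑ σ : Equiv.Perm (Fin n), ∑ k ∈ Finset.range (n + 1),
        (n.choose k : ℝ) * profit g (sampleGreedy g items (PassesFilter g C) σ k)) /
        2 ^ n / n.factorial := by
  rw [RandomizedOnlineAlgorithm.expectedProfit]
  congr 1
  rw [Finset.sum_div]
  refine Finset.sum_congr rfl fun σ _ => ?_
  have h1 : ∀ k : ℕ, (classifierAlgorithm g C n).accepted k (items ∘ σ) =
      sampleGreedy g items (PassesFilter g C) σ k := fun k =>
    profit_accepted_eq items (PassesFilter g C) k σ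
  change ∫ k : ℕ, profit g ((classifierAlgorithm g C n).accepted k (items ∘ σ))
    ∂(ProbabilityTheory.binomial n ⟨1 / 2, by norm_num, by norm_num⟩) = _
  simp only [h1]
  rw [ProbabilityTheory.binomial_eq_sum_dirac, integral_finsetSum_measure, Finset.sum_div]
  · rw [Nat.range_succ_eq_Iic]
    refine Finset.sum_congr rfl fun k hk => ?_
    rw [integral_smul_measure, integral_dirac, ENNReal.toReal_ofReal (by positivity)]
    have : (1 / 2 : ℝ) ^ k * (1 - 1 / 2) ^ (n - k) = 1 / 2 ^ n := by
      rw [show (1 - 1 / 2 : ℝ) = 1 / 2 by norm_num, ← pow_add,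
        Nat.add_sub_cancel' (Finset.mem_Iic.1 hk), div_pow, one_pow]
    simp only [mul_assoc, this, smul_eq_mul]
    ring
  · intro k _
    exact (integrable_dirac (by simp)).smul_measure (by simp)

end

/-! ### Learning a classifier, and nice instances. -/

noncomputable section

variable {d : ℕ} {g : (Fin d → ℝ) → ℝ}

/-! ### Classifiers on a balanced curve -/

lemma pickedSet_anti {ι : Type*} (items : ι → Item d) (A : Finset ι) {l m : Fin d → ℝ}
    (h : l ≤ m) : pickedSet items m A ⊆ pickedSet items l A :=
  Finset.monotone_filter_right A fun i _ hi =>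
    (dotProduct_le_dotProduct_of_nonneg_right h (items i).size_nonneg).trans hi

lemma pickedSet_mono {ι : Type*} (items : ι → Item d) {A B : Finset ι} (l : Fin d → ℝ)
    (h : A ⊆ B) : pickedSet items l A ⊆ pickedSet items l B :=
  Finset.filter_subset_filter _ h

lemma pickedSet_zero {ι : Type*} (items : ι → Item d) (A : Finset ι) :
    pickedSet items 0 A = A :=
  Finset.filter_true_of_mem fun i _ => by simpa using (items i).value_nonneg

lemma IsBalancedCurve.zero_mem {C : Set (Fin d → ℝ)} (hC : IsBalancedCurve g C) : 0 ∈ C := by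
  obtain ⟨γ, -, -, h0, -, -, rfl⟩ := hC
  exact ⟨0, h0⟩

lemma IsBalancedCurve.le_total {C : Set (Fin d → ℝ)} (hC : IsBalancedCurve g C)
    {l m : Fin d → ℝ} (hl : l ∈ C) (hm : m ∈ C) : l ≤ m ∨ m ≤ l := by
  obtain ⟨γ, -, hmono, -, -, -, rfl⟩ := hC
  obtain ⟨s, rfl⟩ := hl
  obtain ⟨t, rfl⟩ := hm
  exact (_root_.le_total s t).imp (fun h => hmono h) fun h => hmono h

/-- Finitely many upward closed conditions that hold somewhere on a nonempty part of the curve hold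
at a common point of it. -/
lemma IsBalancedCurve.exists_forall {C : Set (Fin d → ℝ)} (hC : IsBalancedCurve g C)
    {D : Set (Fin d → ℝ)} (hD : D ⊆ C) (hne : D.Nonempty) {ι : Type*} (p : ι → (Fin d → ℝ) → Prop)
    (hp : ∀ i l m, l ≤ m → p i l → p i m) (S : Finset ι) (hS : ∀ i ∈ S, ∃ l ∈ D, p i l) :
    ∃ l ∈ D, ∀ i ∈ S, p i l := by
  induction S using Finset.induction_on with
  | empty => exact ⟨hne.some, hne.some_mem, by simp⟩
  | insert a S _ ih =>
    obtain ⟨l, hl, h1⟩ := ih fun i hi => hS i (Finset.mem_insert_of_mem hi)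
    obtain ⟨m, hm, h2⟩ := hS a (Finset.mem_insert_self a S)
    rcases hC.le_total (hD hl) (hD hm) with h | h
    · refine ⟨m, hm, fun i hi => ?_⟩
      rcases Finset.mem_insert.1 hi with rfl | hi
      · exact h2
      · exact hp i l m h (h1 i hi)
    · refine ⟨l, hl, fun i hi => ?_⟩
      rcases Finset.mem_insert.1 hi with rfl | hi
      · exact hp i m l h h2
      · exact h1 i hi

lemma mem_candidates_map {ι : Type*} [DecidableEq ι] {C : Set (Fin d → ℝ)} (items : ι → Item d) {ℓ : List ι}
    (hℓ : ℓ.Nodup) (l : Fin d → ℝ) :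
    l ∈ candidates g C (ℓ.map items) ↔ l ∈ C ∧ 1 / (12 * d) * fracOpt g items ℓ.toFinset ≤
      fracOpt g items (pickedSet items l ℓ.toFinset) := by
  rw [candidates, mem_ofPred_eq, fopt_map items hℓ, fopt_picked_map items l hℓ]

lemma candidates_le_iff {d : ℕ} (hd : 1 ≤ d) {a b : ℝ} :
    1 / (12 * (d : ℝ)) * a ≤ b ↔ a ≤ 12 * d * b := by
  have : (0 : ℝ) < 12 * d := by positivity
  rw [one_div, inv_mul_le_iff₀ this]

/-- Passing the filter means passing for all candidates. -/
lemma IsBalancedCurve.passesFilter_iff (hg : IsRegularSupermodularCost g) (hd : 1 ≤ d)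
    {C : Set (Fin d → ℝ)} (hC : IsBalancedCurve g C) {ι : Type*} [DecidableEq ι]
    (items : ι → Item d) {ℓ : List ι} (hℓ : ℓ.Nodup) (e : Item d) :
    PassesFilter g C (ℓ.map items) e ↔
      ∀ l ∈ candidates g C (ℓ.map items), l ⬝ᵥ e.size < e.value := by
  unfold PassesFilter
  split_ifs with h
  · exact ⟨fun h1 l hl => (dotProduct_le_dotProduct_of_nonneg_right (h.choose_spec.2 hl)
      e.size_nonneg).trans_lt h1, fun h1 => h1 _ h.choose_spec.1⟩
  · refine ⟨fun h1 l hl => h1 l hl.1, fun h1 m hm => h1 m ?_⟩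
    -- A point `m` of the curve that is not a candidate bounds the parameters of all candidates.
    -- These form a compact nonempty set, so a greatest candidate would exist after all.
    by_contra hcon
    apply h
    have h0 := hC.zero_mem
    obtain ⟨γ, hcont, hmono, hγ0, -, -, rfl⟩ := hC
    obtain ⟨t₁, rfl⟩ := hm
    set c := 1 / (12 * (d : ℝ)) * fracOpt g items ℓ.toFinset with hc
    have hmem : ∀ t, γ t ∈ candidates g (range γ) (ℓ.map items) ↔
        c ≤ fracOpt g items (pickedSet items (γ t) ℓ.toFinset) := fun t => by
      rw [mem_candidates_map items hℓ]
      exact and_iff_right ⟨t, rfl⟩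
    set T : Set NNReal := {t | γ t ∈ candidates g (range γ) (ℓ.map items)} with hT
    -- Being a candidate means picking every item of one of finitely many valuable sets, and each of
    -- these is a closed condition.
    have hTeq : T = ⋃ B ∈ ℓ.toFinset.powerset.filter fun B => c ≤ fracOpt g items B,
        {t | ∀ j ∈ B, γ t ⬝ᵥ (items j).size ≤ (items j).value} := by
      ext t
      simp only [hT, mem_ofPred_eq, hmem, mem_iUnion, Finset.mem_filter, Finset.mem_powerset,
        exists_prop]
      constructor
      · exact fun h => ⟨_, ⟨Finset.filter_subset _ _, h⟩, fun j hj => (Finset.mem_filter.1 hj).2⟩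
      · rintro ⟨B, ⟨h1, h2⟩, h3⟩
        exact h2.trans (hg.fracOpt_mono items fun j hj => Finset.mem_filter.2 ⟨h1 hj, h3 j hj⟩)
    have hclosed : IsClosed T := by
      rw [hTeq]
      refine isClosed_biUnion_finset fun B _ => ?_
      simp only [ofPred_forall]
      refine isClosed_iInter fun j => isClosed_iInter fun _ => isClosed_le ?_ continuous_const
      fun_prop
    have hbdd : T ⊆ Icc 0 t₁ := by
      refine fun t ht => ⟨zero_le, le_of_not_ge fun hle => hcon ?_⟩
      rw [hmem]
      exact ((hmem t).1 ht).trans (hg.fracOpt_mono items (pickedSet_anti items _ (hmono hle)))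
    have hne : T.Nonempty := by
      refine ⟨0, (hmem 0).2 ?_⟩
      rw [hγ0, pickedSet_zero, hc, candidates_le_iff hd]
      have hd' : (1 : ℝ) ≤ d := by exact_mod_cast hd
      nlinarith [hg.fracOpt_nonneg items ℓ.toFinset]
    obtain ⟨t, ht, hmax⟩ := (isCompact_Icc.of_isClosed_subset hclosed hbdd).exists_isGreatest hne
    refine ⟨γ t, ht, ?_⟩
    rintro _ hl
    obtain ⟨s, rfl⟩ := hl.1
    exact hmono (hmax hl)

/-! ### Learning a classifier from a random half of the items -/

/-- The fractional optimum is not additive, but a light optimum of `A ∩ L` forces a light sum of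
shares, to which Chebyshev's inequality applies. -/
lemma IsRegularSupermodularCost.card_light_le (hg : IsRegularSupermodularCost g) {n : ℕ}
    (items : Fin n → Item d) {A : Finset (Fin n)} {m : ℝ} (hm : 0 ≤ m)
    (hA : ∀ j ∈ A, fracOpt g items {j} ≤ m) :
    ((Finset.univ.filter fun L : Finset (Fin n) =>
      fracOpt g items (A ∩ L) < fracOpt g items A / 4).card : ℝ) * fracOpt g items A ≤
      4 * m * 2 ^ n := by
  obtain ⟨w, h1, h2, h3⟩ := hg.exists_shares items A
  have := card_light_subsets_le hm fun j hj => ⟨(h3 j hj).1, (h3 j hj).2.trans (hA j hj)⟩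
  rw [h1, Fintype.card_fin] at this
  refine le_trans (mul_le_mul_of_nonneg_right ?_ (hg.fracOpt_nonneg items A)) this
  refine Nat.cast_le.2 (Finset.card_le_card (Finset.monotone_filter_right _ fun L _ hL => ?_))
  exact (h2 _ Finset.inter_subset_left).trans_lt hL

/-- A filter passes only items of `Q` that are picked by all classifiers that are good for the
sample, and passes all items of a fixed valuable set `W` if the sample is representative. Then the
greedy solution is good in expectation. -/
lemma IsRegularSupermodularCost.le_sum_sampleGreedy (hg : IsRegularSupermodularCost g)
    (hd : 1 ≤ d) {C : Set (Fin d → ℝ)} (hC : IsBalancedCurve g C) {n : ℕ} (items : Fin n → Item d)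
    {Q W : Finset (Fin n)} (hF : 0 < fracOpt g items Q)
    (hsmall : ∀ j ∈ Q, fracOpt g items {j} ≤ fracOpt g items Q / (10 ^ 4 * d))
    (P : List (Item d) → Item d → Prop)
    (hPick : ∀ ℓ : List (Fin n), ℓ.Nodup → ∀ j, P (ℓ.map items) (items j) → j ∈ Q ∧ ∀ l ∈ C,
      fracOpt g items (Q ∩ ℓ.toFinset) ≤
        12 * d * fracOpt g items (pickedSet items l (Q ∩ ℓ.toFinset)) →
      l ⬝ᵥ (items j).size ≤ (items j).value)
    (hWQ : W ⊆ Q) (hW : fracOpt g items Q / (50 * d) ≤ fracOpt g items W)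
    (hPass : ∀ ℓ : List (Fin n), ℓ.Nodup →
      fracOpt g items Q / 4 ≤ fracOpt g items (Q ∩ ℓ.toFinset) → ∀ j ∈ W,
      P (ℓ.map items) (items j)) :
    n.factorial * (fracOpt g items Q / (200 * d) * (9 / 10 * 2 ^ n)) ≤
      ∑ σ : Equiv.Perm (Fin n), ∑ k ∈ Finset.range (n + 1),
        (n.choose k : ℝ) * profit g (sampleGreedy g items P σ k) := by
  set F := fracOpt g items Q with hFdef
  have hd1 : (1 : ℝ) ≤ d := by exact_mod_cast hd
  have hd0 : (0 : ℝ) < d := by linarith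
  -- The sample must represent `Q`, so that the filter is right, and its complement must retain part
  -- of `W`, so that something is left to accept.
  obtain ⟨good, hgood⟩ : ∃ good : Finset (Fin n) → Prop, ∀ A, good A ↔
      F / 4 ≤ fracOpt g items (Q ∩ A) ∧ fracOpt g items W / 4 ≤ fracOpt g items (W ∩ Aᶜ) :=
    ⟨_, fun _ => Iff.rfl⟩
  have hm0 : 0 ≤ F / (10 ^ 4 * d) := by positivity
  have hF8 : F / (200 * d) ≤ F / (8 * d) - F / (10 ^ 4 * d) := by
    have : F / (8 * d) - F / (10 ^ 4 * d) - F / (200 * d) = F / d * (1199 / 10000) := by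
      field_simp; norm_num
    have h2 : 0 ≤ F / d * (1199 / 10000) := by positivity
    linarith
  refine le_trans (mul_le_mul_of_nonneg_left (mul_le_mul_of_nonneg_left ?_ (by positivity))
    (by positivity)) (mul_card_good_le hg.map_zero items P good (c := F / (200 * d)) ?_)
  · set bad₁ := Finset.univ.filter fun L : Finset (Fin n) => fracOpt g items (Q ∩ L) < F / 4
    set bad₂ := Finset.univ.filter fun L : Finset (Fin n) =>
      fracOpt g items (W ∩ L) < fracOpt g items W / 4
    have h1 : (bad₁.card : ℝ) * F ≤ 4 * (F / (10 ^ 4 * d)) * 2 ^ n :=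
      hg.card_light_le items hm0 hsmall
    have h2 : (bad₂.card : ℝ) * fracOpt g items W ≤ 4 * (F / (10 ^ 4 * d)) * 2 ^ n :=
      hg.card_light_le items hm0 fun j hj => hsmall j (hWQ hj)
    have hcard : 2 ^ n ≤ (Finset.univ.filter good).card + (bad₁.card + bad₂.card) := by
      have hsub : (Finset.univ : Finset (Finset (Fin n))) ⊆
          Finset.univ.filter good ∪ (bad₁ ∪ bad₂.image compl) := by
        intro A _
        by_cases ha : F / 4 ≤ fracOpt g items (Q ∩ A)
        · by_cases hb : fracOpt g items W / 4 ≤ fracOpt g items (W ∩ Aᶜ)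
          · exact Finset.mem_union_left _ (Finset.mem_filter.2 ⟨Finset.mem_univ _, (hgood A).2 ⟨ha, hb⟩⟩)
          · refine Finset.mem_union_right _ (Finset.mem_union_right _ (Finset.mem_image.2
              ⟨Aᶜ, Finset.mem_filter.2 ⟨Finset.mem_univ _, not_le.1 hb⟩, compl_compl A⟩))
        · exact Finset.mem_union_right _ (Finset.mem_union_left _
            (Finset.mem_filter.2 ⟨Finset.mem_univ _, not_le.1 ha⟩))
      have := (Finset.card_le_card hsub).trans ((Finset.card_union_le _ _).trans
        (Nat.add_le_add_left ((Finset.card_union_le _ _).trans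
          (Nat.add_le_add_left Finset.card_image_le _)) _))
      simpa using this
    have hcard' : (2 : ℝ) ^ n ≤ (Finset.univ.filter good).card + (bad₁.card + bad₂.card) := by
      exact_mod_cast hcard
    have hpow : (0 : ℝ) < 2 ^ n := by positivity
    -- The two kinds of failure have probabilities at most `4 / 10 ^ 4` and `200 / 10 ^ 4`, in total
    -- below `1 / 10`. Complementation lets the bound for `W ∩ L` serve for `W ∩ Aᶜ`.
    have h1' : (bad₁.card : ℝ) ≤ 4 / 10 ^ 4 * 2 ^ n := by
      have : 4 * (F / (10 ^ 4 * d)) * 2 ^ n ≤ 4 / 10 ^ 4 * 2 ^ n * F := by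
        have : F / (10 ^ 4 * d) ≤ F / 10 ^ 4 :=
          div_le_div_of_nonneg_left hF.le (by norm_num) (by linarith)
        nlinarith
      exact le_of_mul_le_mul_right (h1.trans this) hF
    have h2' : (bad₂.card : ℝ) ≤ 200 / 10 ^ 4 * 2 ^ n := by
      have h3 := (mul_le_mul_of_nonneg_left hW (Nat.cast_nonneg bad₂.card)).trans h2
      have h4 : 4 * (F / (10 ^ 4 * d)) * 2 ^ n = 200 / 10 ^ 4 * 2 ^ n * (F / (50 * d)) := by
        field_simp; norm_num
      rw [h4] at h3
      exact le_of_mul_le_mul_right h3 (by positivity)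
    linarith
  · intro ℓ₁ ℓ₂ hnd hall hA
    obtain ⟨h1, h2⟩ := (hgood _).1 hA
    have hnd₁ : ℓ₁.Nodup := hnd.of_append_left
    have hnd₂ : ℓ₂.Nodup := hnd.of_append_right
    set f := fracOpt g items (Q ∩ ℓ₁.toFinset) with hf
    have hf0 : 0 ≤ f := hg.fracOpt_nonneg items _
    -- With `G = f / (2 * d)` both `f - d * G = f / 2` and `G` are at least `f / (2 * d)`. Hence `l`
    -- meets the candidate threshold `f / (12 * d)` with room to spare.
    obtain ⟨l, hlC, hl0, hl⟩ := hC.exists_marginalDual_eq hg (G := f / (2 * d)) (by positivity)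
    have hcand : f ≤ 12 * d * fracOpt g items (pickedSet items l (Q ∩ ℓ₁.toFinset)) := by
      have h3 := hg.min_le_fracOpt_pickedSet items (Q ∩ ℓ₁.toFinset) hl0 hl
      have h4 : f / (2 * d) ≤ min (fracOpt g items (Q ∩ ℓ₁.toFinset) - d * (f / (2 * d)))
          (f / (2 * d)) := by
        refine le_min ?_ le_rfl
        have e1 : (d : ℝ) * (f / (2 * d)) = f / 2 := by field_simp
        have e2 : f / (2 * d) ≤ f / 2 := div_le_div_of_nonneg_left hf0 (by norm_num) (by linarith)
        rw [e1, ← hf]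
        linarith
      have h5 := mul_le_mul_of_nonneg_left (h4.trans h3) (by positivity : (0 : ℝ) ≤ 12 * d)
      have h6 : 12 * (d : ℝ) * (f / (2 * d)) = 6 * f := by field_simp; ring
      linarith
    refine le_trans (le_min ?_ ?_) (hg.min_le_profit_greedySolution items hnd₂ hl0
      (G := f / (2 * d)) (ε := F / (10 ^ 4 * d)) (fun i => (hl i).ge)
      (fun j hj => (hPick ℓ₁ hnd₁ j hj).2 l hlC hcand)
      (fun j hj => hsmall j (hPick ℓ₁ hnd₁ j hj).1))
    · have h3 : F / (200 * d) ≤ fracOpt g items W / 4 := by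
        have : F / (200 * d) = F / (50 * d) / 4 := by field_simp; norm_num
        rw [this]
        linarith
      refine (h3.trans h2).trans (hg.fracOpt_mono items fun j hj => ?_)
      rw [Finset.mem_inter, Finset.mem_compl, List.mem_toFinset] at hj
      rw [Finset.mem_filter, List.mem_toFinset]
      exact ⟨(List.mem_append.1 (hall j)).resolve_left hj.2, hPass ℓ₁ hnd₁ h1 j hj.1⟩
    · have : F / (8 * d) ≤ f / (2 * d) := by
        have e : F / (8 * d) = F / 4 / (2 * d) := by field_simp; norm_num
        rw [e]
        exact div_le_div_of_nonneg_right h1 (by positivity)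
      linarith

lemma sum_sampleGreedy_nonneg (h0 : g 0 = 0) {n : ℕ} (items : Fin n → Item d)
    (P : List (Item d) → Item d → Prop) :
    0 ≤ ∑ σ : Equiv.Perm (Fin n), ∑ k ∈ Finset.range (n + 1),
        (n.choose k : ℝ) * profit g (sampleGreedy g items P σ k) :=
  Finset.sum_nonneg fun _ _ => Finset.sum_nonneg fun _ _ =>
    mul_nonneg (Nat.cast_nonneg _) (profit_greedySolution_nonneg h0 _ _)

/-- On nice instances, the classifier algorithm is `O(d)`-competitive. -/
theorem IsRegularSupermodularCost.opt_le_expectedProfit (hg : IsRegularSupermodularCost g)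
    (hd : 1 ≤ d) {C : Set (Fin d → ℝ)} (hC : IsBalancedCurve g C) {n : ℕ} (items : Fin n → Item d)
    (hnice : IsNiceInstance g C items) :
    opt g items ≤ 250 * d * (classifierAlgorithm g C n).expectedProfit g items := by
  have hd1 : (1 : ℝ) ≤ d := by exact_mod_cast hd
  have hd0 : (0 : ℝ) < d := by linarith
  set Z := ∑ σ : Equiv.Perm (Fin n), ∑ k ∈ Finset.range (n + 1),
    (n.choose k : ℝ) * profit g (sampleGreedy g items (PassesFilter g C) σ k) with hZ
  have hE := expectedProfit_classifierAlgorithm (g := g) C items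
  rw [← hZ] at hE
  have hZ0 : 0 ≤ Z := sum_sampleGreedy_nonneg hg.map_zero items _
  rw [hE]
  set F := fracOpt g items Finset.univ with hF
  have hoptF : opt g items ≤ F := hg.opt_le_fracOpt items
  have hfac : (0 : ℝ) < n.factorial := by positivity
  rcases (hg.fracOpt_nonneg items Finset.univ).eq_or_lt with h0 | hpos
  · refine (hoptF.trans h0.ge).trans ?_
    positivity
  have hsmall : ∀ j, fracOpt g items {j} ≤ F / (10 ^ 4 * d) := fun j => by
    refine (hg.fracOpt_single_le items (hnice.not_exceptional j)).trans (max_le (by positivity) ?_)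
    exact (hnice.small_profit j).trans (div_le_div_of_nonneg_right hoptF (by positivity))
  -- The factor `48` is `4 * 12`: if the sample has at least a quarter of `F`, each of its
  -- candidates lies in `D`.
  set D : Set (Fin d → ℝ) := {l | l ∈ C ∧
    F ≤ 48 * d * fracOpt g items (pickedSet items l Finset.univ)} with hD
  set W : Finset (Fin n) := Finset.univ.filter fun j =>
    ∀ l ∈ D, l ⬝ᵥ (items j).size < (items j).value with hWdef
  have hDne : D.Nonempty := ⟨0, hC.zero_mem, by
    rw [pickedSet_zero]; nlinarith⟩
  have hW : F / (50 * d) ≤ fracOpt g items W := by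
    -- Since the curve is a chain, a single `l` in `D` strictly picks no item outside `W`. The items
    -- picked by `l` thus lie in `W`, except for a possible tie, and general position leaves at most
    -- one small tied item. This loss turns `48` into `50`.
    obtain ⟨l, hlD, hl⟩ := hC.exists_forall (D := D) (fun l hl => hl.1) hDne
      (fun (j : Fin n) l => (items j).value ≤ l ⬝ᵥ (items j).size)
      (fun j l m hlm h => h.trans
        (dotProduct_le_dotProduct_of_nonneg_right hlm (items j).size_nonneg)) Wᶜ
      (fun j hj => by simpa [hWdef] using hj)
    set T : Finset (Fin n) := Finset.univ.filter fun j =>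
      (items j).value = l ⬝ᵥ (items j).size with hT
    have hsub : pickedSet items l Finset.univ ⊆ W ∪ T := by
      intro j hj
      by_cases hjW : j ∈ W
      · exact Finset.mem_union_left _ hjW
      · exact Finset.mem_union_right _ (Finset.mem_filter.2 ⟨Finset.mem_univ _,
          le_antisymm (hl j (Finset.mem_compl.2 hjW)) (Finset.mem_filter.1 hj).2⟩)
    have hTsmall : fracOpt g items T ≤ F / (10 ^ 4 * d) := by
      rcases T.eq_empty_or_nonempty with h | ⟨j, hj⟩
      · rw [h]
        refine fracOpt_le fun x _ => ?_
        simp only [fracValue, Finset.sum_empty, hg.map_zero, sub_zero]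
        positivity
      · refine (hg.fracOpt_mono items fun i hi => Finset.mem_singleton.2 ?_).trans (hsmall j)
        exact hnice.general_position l hlD.1 i j (Finset.mem_filter.1 hi).2
          (Finset.mem_filter.1 hj).2
    have h1 := hlD.2.trans (mul_le_mul_of_nonneg_left ((hg.fracOpt_mono items hsub).trans
      ((hg.fracOpt_union_le items W T).trans (add_le_add_right hTsmall _)))
      (by positivity : (0 : ℝ) ≤ 48 * d))
    have h2 : 48 * (d : ℝ) * (F / (10 ^ 4 * d)) = 48 / 10 ^ 4 * F := by field_simp
    rw [mul_add, h2] at h1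
    rw [div_le_iff₀ (by positivity)]
    nlinarith
  have hmain := hg.le_sum_sampleGreedy hd hC items (Q := Finset.univ) (W := W) hpos
    (fun j _ => hsmall j) (PassesFilter g C)
    (fun ℓ hℓ j hj => ⟨Finset.mem_univ j, fun l hl hle => by
      rw [Finset.univ_inter] at hle
      refine ((hC.passesFilter_iff hg hd items hℓ _).1 hj l ?_).le
      rw [mem_candidates_map items hℓ, candidates_le_iff hd]
      exact ⟨hl, hle⟩⟩)
    (Finset.subset_univ W) hW
    (fun ℓ hℓ hle j hj => by
      rw [Finset.univ_inter] at hle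
      refine (hC.passesFilter_iff hg hd items hℓ _).2 fun l hl => ?_
      rw [mem_candidates_map items hℓ, candidates_le_iff hd] at hl
      refine (Finset.mem_filter.1 hj).2 l ⟨hl.1, ?_⟩
      have h1 := hg.fracOpt_mono items (pickedSet_mono items l (Finset.subset_univ ℓ.toFinset))
      have h2 := mul_le_mul_of_nonneg_left h1 (by positivity : (0 : ℝ) ≤ 12 * d)
      show F ≤ _
      linarith [hl.2])
  rw [← hZ, ← hF] at hmain
  have h1 : F / (200 * d) * (9 / 10) ≤ Z / 2 ^ n / n.factorial := by
    rw [le_div_iff₀ hfac, le_div_iff₀ (by positivity)]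
    linarith
  have h2 := mul_le_mul_of_nonneg_left h1 (by positivity : (0 : ℝ) ≤ 250 * d)
  have h3 : 250 * (d : ℝ) * (F / (200 * d) * (9 / 10)) = 9 / 8 * F := by
    field_simp; ring
  linarith

end

/-! ### Arbitrary instances: exceptional items, record rules, and their mixture. -/

noncomputable section

variable {d : ℕ} {g : (Fin d → ℝ) → ℝ}

/-! ### Exceptional items in an optimal solution -/

/-- In an optimal solution, an exceptional item is larger in some coordinate than all other items
together. -/
lemma IsRegularSupermodularCost.exists_lt_of_isExceptional (hg : IsRegularSupermodularCost g)
    {e : Item d} (he : IsExceptional g e) {T : Fin d → ℝ} (hT : 0 ≤ T)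
    (hopt : g (T + e.size) - g T ≤ e.value) : ∃ i, T i < e.size i := by
  by_contra! hcon
  have hle : e.size ≤ T := hcon
  have h1 : ¬ IsMaxOn (fun θ : ℝ => θ * e.value - g (θ • e.size)) (Icc 0 1) 1 := fun h =>
    (he 1 ⟨zero_le_one, le_rfl⟩ h).2.false
  simp only [isMaxOn_iff, not_forall, not_le, one_mul, one_smul] at h1
  obtain ⟨θ, hθ, h1⟩ := h1
  have h0 : 0 ≤ 1 - θ := sub_nonneg.2 hθ.2
  -- If `e.size ≤ T`, completing `e` from extent `θ` to `1` on its own costs no more than adding `(1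
  -- - θ) • e.size` on top of `T`. By convexity this is at most `1 - θ` times the marginal cost of
  -- `e`, hence at most `(1 - θ)` times its value, so extent `1` is no worse than `θ`.
  have h2 := hg.increments (smul_nonneg hθ.1 e.size_nonneg)
    ((smul_le_of_le_one_left e.size_nonneg hθ.2).trans hle) (smul_nonneg h0 e.size_nonneg)
  have h3 := hg.convexOn.2 hT (add_nonneg hT e.size_nonneg) hθ.1 h0 (add_sub_cancel θ 1)
  have e1 : θ • e.size + (1 - θ) • e.size = e.size := by rw [← add_smul]; simp
  have e2 : θ • T + (1 - θ) • (T + e.size) = T + (1 - θ) • e.size := by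
    rw [smul_add, ← add_assoc, ← add_smul]; simp
  rw [e1] at h2
  rw [e2, smul_eq_mul, smul_eq_mul] at h3
  have h4 := mul_le_mul_of_nonneg_left hopt h0
  linarith

/-- An optimal solution contains at most `d` exceptional items. -/
lemma IsRegularSupermodularCost.opt_le_add_fracOpt (hg : IsRegularSupermodularCost g)
    (hd : 1 ≤ d) {n : ℕ} (items : Fin n → Item d) {M : ℝ} (hM : 0 ≤ M) (hprofit : ∀ j, profit g {items j} ≤ M) :
    opt g items ≤ d * M +
      fracOpt g items (Finset.univ.filter fun j => ¬ IsExceptional g (items j)) := by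
  obtain ⟨A, -, hA⟩ := Finset.exists_mem_eq_sup' (Finset.univ_nonempty (α := Finset (Fin n)))
    fun A : Finset (Fin n) => profit g (A.val.map items)
  have hle : ∀ B : Finset (Fin n), profit g (B.val.map items) ≤ profit g (A.val.map items) :=
    fun B => by
      rw [← hA]
      exact Finset.le_sup' (fun A : Finset (Fin n) => profit g (A.val.map items))
        (Finset.mem_univ B)
  have hprof : ∀ B : Finset (Fin n), profit g (B.val.map items) =
      ∑ j ∈ B, (items j).value - g (∑ j ∈ B, (items j).size) := fun B => by
    rw [← fracValue_one]; simp [fracValue]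
  have hsum : ∀ B : Finset (Fin n), 0 ≤ ∑ j ∈ B, (items j).size := fun B =>
    Finset.sum_nonneg fun j _ => (items j).size_nonneg
  rw [opt, hA]
  set X := A.filter fun j => IsExceptional g (items j) with hX
  set Y := A.filter fun j => ¬ IsExceptional g (items j) with hY
  have hcard : X.card ≤ d := by
    have hex : ∀ j ∈ X, ∃ i, ∑ f ∈ X.erase j, (items f).size i < (items j).size i := by
      intro j hj
      obtain ⟨hjA, hjX⟩ := Finset.mem_filter.1 hj
      have h1 := hle (A.erase j)
      rw [hprof, hprof, ← Finset.sum_erase_add A _ hjA, ← Finset.sum_erase_add A _ hjA] at h1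
      obtain ⟨i, hi⟩ := hg.exists_lt_of_isExceptional hjX (hsum (A.erase j)) (by linarith)
      refine ⟨i, lt_of_le_of_lt ?_ hi⟩
      rw [Finset.sum_apply]
      exact Finset.sum_le_sum_of_subset_of_nonneg
        (Finset.erase_subset_erase j (Finset.filter_subset _ A))
        fun f _ _ => (items f).size_nonneg i
    have : Nonempty (Fin d) := ⟨⟨0, hd⟩⟩
    choose! c hc using hex
    -- Two exceptional items cannot each exceed the other in the same coordinate.
    have hinj : Set.InjOn c X := by
      intro j hj f hf hjf
      by_contra hne
      have h1 := hc j hj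
      have h2 := hc f hf
      have h3 := Finset.single_le_sum (f := fun e => (items e).size (c j))
        (fun e _ => (items e).size_nonneg _) (Finset.mem_erase.2 ⟨Ne.symm hne, hf⟩)
      have h4 := Finset.single_le_sum (f := fun e => (items e).size (c f))
        (fun e _ => (items e).size_nonneg _) (Finset.mem_erase.2 ⟨hne, hj⟩)
      simp only [← hjf] at h2 h3 h4
      linarith
    simpa using Finset.card_le_card_of_injOn c (fun j _ => Finset.mem_univ (c j)) hinj
  have hXsum : profit g (X.val.map items) ≤ X.card * M := by
    have hcost : ∀ B : Finset (Fin n),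
        ∑ j ∈ B, g (items j).size ≤ g (∑ j ∈ B, (items j).size) := by
      intro B
      induction B using Finset.induction_on with
      | empty => simp [hg.map_zero]
      | insert a B ha ih =>
        rw [Finset.sum_insert ha, Finset.sum_insert ha]
        exact (add_le_add_right ih _).trans (hg.superadditive (items a).size_nonneg (hsum B))
    have h1 : ∑ j ∈ X, ((items j).value - g (items j).size) ≤ X.card * M := by
      rw [← nsmul_eq_mul, ← Finset.sum_const]
      exact Finset.sum_le_sum fun j _ => by simpa [profit] using hprofit j
    rw [Finset.sum_sub_distrib] at h1
    rw [hprof]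
    linarith [hcost X]
  have hsplit : profit g (A.val.map items) ≤
      profit g (X.val.map items) + profit g (Y.val.map items) := by
    rw [hprof, hprof, hprof, ← Finset.sum_filter_add_sum_filter_not A
      (fun j => IsExceptional g (items j)), ← Finset.sum_filter_add_sum_filter_not A
      (fun j => IsExceptional g (items j)) fun j => (items j).size]
    linarith [hg.superadditive (hsum X) (hsum Y)]
  have hYle : profit g (Y.val.map items) ≤
      fracOpt g items (Finset.univ.filter fun j => ¬ IsExceptional g (items j)) :=
    (hg.profit_le_fracOpt items Y).trans
      (hg.fracOpt_mono items (Finset.filter_subset_filter _ (Finset.subset_univ A)))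
  have : (X.card : ℝ) * M ≤ d * M := mul_le_mul_of_nonneg_right (Nat.cast_le.2 hcard) hM
  linarith

/-! ### Filters for arbitrary instances -/

/-- The filter that ignores exceptional items, and passes items picked by every candidate. -/
def RegularFilter (g : (Fin d → ℝ) → ℝ) (C : Set (Fin d → ℝ)) (L : List (Item d)) (e : Item d) :
    Prop :=
  ¬ IsExceptional g e ∧
    ∀ l ∈ candidates g C (L.filter fun f => ¬ IsExceptional g f), l ⬝ᵥ e.size ≤ e.value

/-- The filter that passes items that are strictly more profitable than the whole sample. -/
def RecordFilter (g : (Fin d → ℝ) → ℝ) (L : List (Item d)) (e : Item d) : Prop :=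
  0 ≤ profit g {e} ∧ ∀ f ∈ L, profit g {f} < profit g {e}

/-- The filter that passes items that are at least as profitable as the whole sample. -/
def WeakRecordFilter (g : (Fin d → ℝ) → ℝ) (L : List (Item d)) (e : Item d) : Prop :=
  0 ≤ profit g {e} ∧ ∀ f ∈ L, profit g {f} ≤ profit g {e}

/-- Greedy solutions for the regular filter are good if the items that are not exceptional are
small. -/
lemma IsRegularSupermodularCost.le_sum_regularFilter (hg : IsRegularSupermodularCost g)
    (hd : 1 ≤ d) {C : Set (Fin d → ℝ)} (hC : IsBalancedCurve g C) {n : ℕ} (items : Fin n → Item d)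
    {F : ℝ} (hFdef : F = fracOpt g items (Finset.univ.filter fun j => ¬ IsExceptional g (items j)))
    (hF : 0 < F) (hsmall : ∀ j, profit g {items j} ≤ F / (10 ^ 4 * d)) :
    n.factorial * (F / (200 * d) * (9 / 10 * 2 ^ n)) ≤
      ∑ σ : Equiv.Perm (Fin n), ∑ k ∈ Finset.range (n + 1),
        (n.choose k : ℝ) * profit g (sampleGreedy g items (RegularFilter g C) σ k) := by
  have hd1 : (1 : ℝ) ≤ d := by exact_mod_cast hd
  set Q : Finset (Fin n) := Finset.univ.filter fun j => ¬ IsExceptional g (items j) with hQ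
  have hfilter : ∀ ℓ : List (Fin n), ((ℓ.map items).filter fun f => ¬ IsExceptional g f) =
      (ℓ.filter fun j => ¬ IsExceptional g (items j)).map items := fun ℓ => by
    rw [List.filter_map]; rfl
  have hset : ∀ ℓ : List (Fin n), (ℓ.filter fun j => ¬ IsExceptional g (items j)).toFinset =
      Q ∩ ℓ.toFinset := fun ℓ => by
    ext j; simp [hQ, and_comm]
  have hcand : ∀ ℓ : List (Fin n), ℓ.Nodup → ∀ l,
      l ∈ candidates g C ((ℓ.map items).filter fun f => ¬ IsExceptional g f) ↔
      l ∈ C ∧ fracOpt g items (Q ∩ ℓ.toFinset) ≤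
        12 * d * fracOpt g items (pickedSet items l (Q ∩ ℓ.toFinset)) := fun ℓ hℓ l => by
    rw [hfilter, mem_candidates_map items (hℓ.filter _), candidates_le_iff hd, hset]
  set D : Set (Fin d → ℝ) := {l | l ∈ C ∧
    F ≤ 48 * d * fracOpt g items (pickedSet items l Q)} with hD
  set W : Finset (Fin n) := Q.filter fun j =>
    ∀ l ∈ D, l ⬝ᵥ (items j).size ≤ (items j).value with hWdef
  have hDne : D.Nonempty := ⟨0, hC.zero_mem, by
    rw [pickedSet_zero, ← hFdef]; nlinarith⟩
  have hW : F / (50 * d) ≤ fracOpt g items W := by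
    -- The filter is non-strict here, so items outside `W` are strictly below some price vector in
    -- `D` and no tied items have to be discarded.
    obtain ⟨l, hlD, hl⟩ := hC.exists_forall (D := D) (fun l hl => hl.1) hDne
      (fun (j : Fin n) l => (items j).value < l ⬝ᵥ (items j).size)
      (fun j l m hlm h => h.trans_le
        (dotProduct_le_dotProduct_of_nonneg_right hlm (items j).size_nonneg)) (Q \ W)
      (fun j hj => by
        obtain ⟨h1, h2⟩ := Finset.mem_sdiff.1 hj
        simpa [hWdef, h1] using h2)
    have hsub : pickedSet items l Q ⊆ W := by
      intro j hj
      obtain ⟨h1, h2⟩ := Finset.mem_filter.1 hj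
      by_contra hjW
      exact (hl j (Finset.mem_sdiff.2 ⟨h1, hjW⟩)).not_ge h2
    have h1 := hlD.2.trans (mul_le_mul_of_nonneg_left (hg.fracOpt_mono items hsub)
      (by positivity : (0 : ℝ) ≤ 48 * d))
    have h2 : 0 ≤ d * fracOpt g items W := mul_nonneg (by positivity) (hg.fracOpt_nonneg items W)
    rw [div_le_iff₀ (by positivity)]
    linarith
  have hmain := hg.le_sum_sampleGreedy hd hC items (Q := Q) (W := W) (hFdef ▸ hF)
    (fun j hj => by
      rw [← hFdef]
      exact (hg.fracOpt_single_le items (Finset.mem_filter.1 hj).2).trans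
        (max_le (by positivity) (hsmall j)))
    (RegularFilter g C)
    (fun ℓ hℓ j hj => ⟨Finset.mem_filter.2 ⟨Finset.mem_univ j, hj.1⟩, fun l hl hle =>
      hj.2 l ((hcand ℓ hℓ l).2 ⟨hl, hle⟩)⟩)
    (Finset.filter_subset _ _) (hFdef ▸ hW)
    (fun ℓ hℓ hle j hj => by
      obtain ⟨hjQ, hjD⟩ := Finset.mem_filter.1 hj
      refine ⟨(Finset.mem_filter.1 hjQ).2, fun l hl => ?_⟩
      rw [hcand ℓ hℓ] at hl
      refine hjD l ⟨hl.1, ?_⟩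
      rw [← hFdef] at hle
      have h1 := hg.fracOpt_mono items (pickedSet_mono items l
        (Finset.inter_subset_left : Q ∩ ℓ.toFinset ⊆ Q))
      have h2 := mul_le_mul_of_nonneg_left h1 (by positivity : (0 : ℝ) ≤ 12 * d)
      linarith [hl.2])
  rwa [← hFdef] at hmain

/-- One of the two record filters selects a most profitable item with constant probability. -/
lemma le_sum_recordFilter (h0 : g 0 = 0) {n : ℕ} (items : Fin n → Item d) (a : Fin n)
    (ha : 0 ≤ profit g {items a}) (hmax : ∀ j, profit g {items j} ≤ profit g {items a}) :
    n.factorial * (profit g {items a} * (2 ^ n / 4)) ≤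
      ∑ σ : Equiv.Perm (Fin n), ∑ k ∈ Finset.range (n + 1),
        (n.choose k : ℝ) * profit g (sampleGreedy g items (RecordFilter g) σ k) ∨
    n.factorial * (profit g {items a} * (2 ^ n / 4)) ≤
      ∑ σ : Equiv.Perm (Fin n), ∑ k ∈ Finset.range (n + 1),
        (n.choose k : ℝ) * profit g (sampleGreedy g items (WeakRecordFilter g) σ k) := by
  -- `S` holds a second most profitable item, or is empty if `a` is the only item. With probability
  -- at least `1 / 4` the sample contains `S` and misses `a`.
  obtain ⟨S, hS1, haS, hS⟩ : ∃ S : Finset (Fin n), S.card ≤ 1 ∧ a ∉ S ∧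
      ∀ i, i ≠ a → ∃ s ∈ S, profit g {items i} ≤ profit g {items s} := by
    rcases (Finset.univ.erase a).eq_empty_or_nonempty with h | h
    · refine ⟨∅, by simp, by simp, fun i hi => ?_⟩
      have : i ∈ Finset.univ.erase a := Finset.mem_erase.2 ⟨hi, Finset.mem_univ i⟩
      rw [h] at this
      exact (Finset.notMem_empty i this).elim
    · obtain ⟨s, hs, hsmax⟩ := Finset.exists_max_image _ (fun i => profit g {items i}) h
      refine ⟨{s}, by simp, ?_, fun i hi => ⟨s, Finset.mem_singleton_self s,
        hsmax i (Finset.mem_erase.2 ⟨hi, Finset.mem_univ i⟩)⟩⟩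
      rw [Finset.mem_singleton]
      exact (Finset.ne_of_mem_erase hs).symm
  obtain ⟨good, hgood⟩ : ∃ good : Finset (Fin n) → Prop, ∀ A, good A ↔ S ⊆ A ∧ a ∉ A :=
    ⟨_, fun _ => Iff.rfl⟩
  have hcard : (2 : ℝ) ^ n / 4 ≤ (Finset.univ.filter good).card := by
    have e1 : Finset.univ.filter good = Finset.Icc S {a}ᶜ := by
      ext A
      simp [hgood, Finset.subset_compl_singleton]
    have hsub : S ⊆ {a}ᶜ := Finset.subset_compl_singleton.2 haS
    have hn : 1 ≤ n := Nat.one_le_iff_ne_zero.2 fun h => by subst h; exact a.elim0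
    rw [e1, Finset.card_Icc_finset hsub, Finset.card_compl, Finset.card_singleton,
      Fintype.card_fin, div_le_iff₀ (by norm_num)]
    have : (2 : ℝ) ^ n ≤ 2 ^ (n - 1 - S.card + 2) :=
      pow_le_pow_right₀ (by norm_num) (by omega)
    rw [pow_add] at this
    push_cast
    linarith
  have key : ∀ P : List (Item d) → Item d → Prop,
      (∀ ℓ₁ ℓ₂ : List (Fin n), (ℓ₁ ++ ℓ₂).Nodup → S ⊆ ℓ₁.toFinset → a ∉ ℓ₁ →
        P (ℓ₁.map items) (items a) ∧ ∀ j ∈ ℓ₂, P (ℓ₁.map items) (items j) →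
          profit g {items a} ≤ profit g {items j}) →
      n.factorial * (profit g {items a} * (2 ^ n / 4)) ≤
        ∑ σ : Equiv.Perm (Fin n), ∑ k ∈ Finset.range (n + 1),
          (n.choose k : ℝ) * profit g (sampleGreedy g items P σ k) := by
    intro P hP
    refine le_trans (mul_le_mul_of_nonneg_left (mul_le_mul_of_nonneg_left hcard ha)
      (by positivity)) (mul_card_good_le h0 items P good ?_)
    intro ℓ₁ ℓ₂ hnd hall hA
    obtain ⟨h1, h2⟩ := (hgood _).1 hA
    rw [List.mem_toFinset] at h2
    obtain ⟨h3, h4⟩ := hP ℓ₁ ℓ₂ hnd h1 h2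
    refine le_profit_greedySolution_of_forall h0 ha (fun e he hPe => ?_)
      ⟨items a, List.mem_map_of_mem ((List.mem_append.1 (hall a)).resolve_left h2), h3⟩
    obtain ⟨j, hj, rfl⟩ := List.mem_map.1 he
    exact h4 j hj hPe
  -- If the second best ties with `a`, every weak record after a good sample is as profitable as
  -- `a`. Otherwise `a` is the only strict record there.
  by_cases hex : ∃ s ∈ S, profit g {items a} ≤ profit g {items s}
  · obtain ⟨s, hs, hsa⟩ := hex
    refine Or.inr (key _ fun ℓ₁ ℓ₂ _ h1 _ => ⟨⟨ha, fun f hf => ?_⟩, fun j _ hj => ?_⟩)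
    · obtain ⟨i, -, rfl⟩ := List.mem_map.1 hf
      exact hmax i
    · exact hsa.trans (hj.2 _ (List.mem_map_of_mem (List.mem_toFinset.1 (h1 hs))))
  · push Not at hex
    refine Or.inl (key _ fun ℓ₁ ℓ₂ _ h1 h2 => ⟨⟨ha, fun f hf => ?_⟩, fun j _ hj => ?_⟩)
    · obtain ⟨i, hi, rfl⟩ := List.mem_map.1 hf
      obtain ⟨s, hs, his⟩ := hS i fun h => h2 (h ▸ hi)
      exact his.trans_lt (hex s hs)
    · by_cases hja : j = a
      · rw [hja]
      · obtain ⟨s, hs, hjs⟩ := hS j hja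
        exact absurd hjs (hj.2 _ (List.mem_map_of_mem (List.mem_toFinset.1 (h1 hs)))).not_ge

/-! ### Mixtures of filters -/

/-- The algorithm that chooses one of three filters at random, and then samples a binomial number
of items and accepts greedily. -/
def mixedSampleGreedy (g : (Fin d → ℝ) → ℝ) (P : Fin 3 → List (Item d) → Item d → Prop) (n : ℕ) :
    RandomizedOnlineAlgorithm d where
  Seed := Fin 3 × Finset (Fin n)
  measurableSpace := ⊤
  law := @PMF.toMeasure _ ⊤ (PMF.uniformOfFintype (Fin 3 × Finset (Fin n)))
  isProbabilityMeasure := @PMF.toMeasure.isProbabilityMeasure _ ⊤ _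
  accept ω past e := SampleGreedyAccepts g (P ω.1) ω.2.card past e
  measurableSet_accept _ _ := MeasurableSpace.measurableSet_top

lemma expectedProfit_mixedSampleGreedy {n : ℕ} (P : Fin 3 → List (Item d) → Item d → Prop)
    (items : Fin n → Item d) :
    (mixedSampleGreedy g P n).expectedProfit g items =
      (∑ i, ∑ σ : Equiv.Perm (Fin n), ∑ k ∈ Finset.range (n + 1),
        (n.choose k : ℝ) * profit g (sampleGreedy g items (P i) σ k)) /
        (3 * 2 ^ n) / n.factorial := by
  rw [RandomizedOnlineAlgorithm.expectedProfit]
  congr 1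
  rw [Finset.sum_comm, Finset.sum_div]
  refine Finset.sum_congr rfl fun σ _ => ?_
  let _ : MeasurableSpace (Fin 3 × Finset (Fin n)) := ⊤
  have h1 : ∀ ω : Fin 3 × Finset (Fin n), (mixedSampleGreedy g P n).accepted ω (items ∘ σ) =
      sampleGreedy g items (P ω.1) σ ω.2.card := fun ω =>
    profit_accepted_eq items (P ω.1) ω.2.card σ
  change ∫ ω : Fin 3 × Finset (Fin n), profit g ((mixedSampleGreedy g P n).accepted ω (items ∘ σ))
    ∂(PMF.uniformOfFintype (Fin 3 × Finset (Fin n))).toMeasure = _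
  simp only [h1]
  have : MeasurableSingletonClass (Fin 3 × Finset (Fin n)) := ⟨fun _ => trivial⟩
  rw [PMF.integral_eq_sum]
  simp only [PMF.uniformOfFintype_apply, smul_eq_mul]
  rw [← Finset.mul_sum, Fintype.sum_prod_type, div_eq_inv_mul]
  congr 1
  · simp
  · refine Finset.sum_congr rfl fun i _ => ?_
    -- The cardinality of a uniformly random subset of `Fin n` has the binomial distribution with
    -- parameter `1 / 2`.
    have := Finset.sum_powerset_apply_card (fun k => profit g (sampleGreedy g items (P i) σ k))
      (x := (Finset.univ : Finset (Fin n)))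
    simpa [Finset.powerset_univ, nsmul_eq_mul] using this

/-- For arbitrary instances, a mixture of the regular filter and the record filters is
`O(d)`-competitive. -/
theorem IsRegularSupermodularCost.opt_le_mixedSampleGreedy (hg : IsRegularSupermodularCost g)
    (hd : 1 ≤ d) {C : Set (Fin d → ℝ)} (hC : IsBalancedCurve g C) {n : ℕ}
    (items : Fin n → Item d) :
    opt g items ≤ 130000 * d * (mixedSampleGreedy g
      ![RegularFilter g C, RecordFilter g, WeakRecordFilter g] n).expectedProfit g items := by
  have hd1 : (1 : ℝ) ≤ d := by exact_mod_cast hd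
  have hd0 : (0 : ℝ) < d := by linarith
  rw [expectedProfit_mixedSampleGreedy, Fin.sum_univ_three]
  simp only [Matrix.cons_val_zero, Matrix.cons_val_one, Matrix.cons_val]
  have hZ₀ := sum_sampleGreedy_nonneg hg.map_zero items (RegularFilter g C)
  have hZ₁ := sum_sampleGreedy_nonneg hg.map_zero items (RecordFilter g)
  have hZ₂ := sum_sampleGreedy_nonneg hg.map_zero items (WeakRecordFilter g)
  set Z₀ := ∑ σ : Equiv.Perm (Fin n), ∑ k ∈ Finset.range (n + 1),
    (n.choose k : ℝ) * profit g (sampleGreedy g items (RegularFilter g C) σ k) with hZ₀def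
  have hrec := le_sum_recordFilter hg.map_zero items
  set Z₁ := ∑ σ : Equiv.Perm (Fin n), ∑ k ∈ Finset.range (n + 1),
    (n.choose k : ℝ) * profit g (sampleGreedy g items (RecordFilter g) σ k)
  set Z₂ := ∑ σ : Equiv.Perm (Fin n), ∑ k ∈ Finset.range (n + 1),
    (n.choose k : ℝ) * profit g (sampleGreedy g items (WeakRecordFilter g) σ k)
  have hfac : (0 : ℝ) < n.factorial := by positivity
  have hpow : (0 : ℝ) < 2 ^ n := by positivity
  have hE : ∀ {c : ℝ}, n.factorial * (c * 2 ^ n) ≤ Z₀ + Z₁ + Z₂ →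
      c / 3 ≤ (Z₀ + Z₁ + Z₂) / (3 * 2 ^ n) / n.factorial := fun {c} h => by
    rw [le_div_iff₀ hfac, le_div_iff₀ (by positivity)]
    linarith
  set F := fracOpt g items (Finset.univ.filter fun j => ¬ IsExceptional g (items j)) with hF
  have hF0 : 0 ≤ F := hg.fracOpt_nonneg items _
  -- If all profits are small, exceptional items add at most `F / 10 ^ 4` to `F`. Otherwise `F < 10
  -- ^ 4 * d * M`, so `opt` is at most `10001 * d * M`, while a record rule chosen with probability
  -- `1 / 3` earns at least `M / 4` on average. This needs a constant of at least `12 * 10001`.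
  by_cases hsmall : ∀ j, profit g {items j} ≤ F / (10 ^ 4 * d)
  · have h1 := hg.opt_le_add_fracOpt hd items (by positivity) hsmall
    rw [← hF] at h1
    have e1 : (d : ℝ) * (F / (10 ^ 4 * d)) = F / 10 ^ 4 := by field_simp
    rw [e1] at h1
    rcases hF0.eq_or_lt with h0 | hpos
    · rw [← h0] at h1
      refine (h1.trans (by norm_num)).trans (mul_nonneg (by positivity) ?_)
      positivity
    have h2 := hg.le_sum_regularFilter hd hC items hF hpos hsmall
    rw [← hZ₀def] at h2
    have h3 := hE (c := F / (200 * d) * (9 / 10)) (by linarith)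
    have h4 := mul_le_mul_of_nonneg_left h3 (by positivity : (0 : ℝ) ≤ 130000 * d)
    have e2 : 130000 * (d : ℝ) * (F / (200 * d) * (9 / 10) / 3) = 195 * F := by
      field_simp; ring
    linarith
  · push Not at hsmall
    obtain ⟨j, hj⟩ := hsmall
    obtain ⟨a, -, ha⟩ := Finset.exists_max_image Finset.univ (fun i => profit g {items i})
      ⟨j, Finset.mem_univ j⟩
    set M := profit g {items a}
    have hFM : F / (10 ^ 4 * d) < M := hj.trans_le (ha j (Finset.mem_univ j))
    have hM : 0 ≤ M := le_trans (by positivity) hFM.le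
    have h1 := hg.opt_le_add_fracOpt hd items hM fun i => ha i (Finset.mem_univ i)
    rw [← hF] at h1
    rw [div_lt_iff₀ (by positivity)] at hFM
    have h3 : M / 4 / 3 ≤ (Z₀ + Z₁ + Z₂) / (3 * 2 ^ n) / n.factorial := hE (by
      rcases hrec a hM fun i => ha i (Finset.mem_univ i) with h | h <;> linarith)
    have h4 := mul_le_mul_of_nonneg_left h3 (by positivity : (0 : ℝ) ≤ 130000 * d)
    have h5 : 0 ≤ d * M := by positivity
    linarith

end

/-! ### Assembly with a common constant. -/

theorem mainTheorem1 :
    ∃ K : ℝ, 0 < K ∧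
      ∀ (d : ℕ), 1 ≤ d → ∀ (g : (Fin d → ℝ) → ℝ), IsRegularSupermodularCost g →
        (∃ C, IsBalancedCurve g C) ∧
        (∀ C, IsBalancedCurve g C → ∀ (n : ℕ) (items : Fin n → Item d),
          IsNiceInstance g C items →
            opt g items ≤ K * d * (classifierAlgorithm g C n).expectedProfit g items) ∧
        (∀ n : ℕ, ∃ 𝒜 : RandomizedOnlineAlgorithm d, ∀ items : Fin n → Item d,
          opt g items ≤ K * d * 𝒜.expectedProfit g items) := by
  refine ⟨130000, by norm_num, fun d hd g hg => ?_⟩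
  obtain ⟨C, hC⟩ := hg.exists_isBalancedCurve
  refine ⟨⟨C, hC⟩, fun C hC n items hnice => ?_, fun n =>
    ⟨_, fun items => hg.opt_le_mixedSampleGreedy hd hC items⟩⟩
  refine (hg.opt_le_expectedProfit hd hC items hnice).trans
    (mul_le_mul_of_nonneg_right (mul_le_mul_of_nonneg_right (by norm_num) (Nat.cast_nonneg d)) ?_)
  rw [expectedProfit_classifierAlgorithm]
  have := sum_sampleGreedy_nonneg hg.map_zero items (PassesFilter g C)
  positivity
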